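/- Notation: $\rho(x)=\frac{4}{1+x^2}$ is the Benjamin–Ono soliton, $\langle\alpha\rangle=(1+\alpha^2)^{1/2}$, $|D|$ is the Fourier multiplier with symbol $|\xi|$, and $H^{k,\sigma}=\{u:\langle\alpha\rangle^{\sigma}u\in H^k(\mathbb R)\}$. Elements of $H^2(\mathbb R)$ are identified with their continuous representatives. (1) Rescaled form. Let $\epsilon>0$ and let $\phi$ be a real-valued even function with $\phi,\ \alpha\phi\in H^2(\mathbb R)$ solving the rescaled Babenko equation $$-\phi-|D|\phi+\tfrac12\phi^2=\frac{\epsilon}{(1+\epsilon)^2}\Big(-\phi|D|\phi-\tfrac12|D|\phi^2\Big)+\frac{\epsilon^2}{(1+\epsilon)^2}\Big(\tfrac12\phi|D|\phi^2-\tfrac12\phi^2|D|\phi-\tfrac16|D|\phi^3\Big).$$ Then there are real numbers $a_1,a_2,\dots$ such that for every $N\ge1$ $$\phi=\rho+\sum_{j=1}^N a_j\rho^j+g_N,\qquad g_N\in H^{2,2N},\qquad g_N(\alpha)=o(\langle\alpha\rangle^{-2N})\ \text{ as } |\alpha|\to\infty.$$ (2) Original variables. Let $g>0$, $\gamma\ne0$,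 $c\in\mathbb R$ with $g+c\gamma<0$, put $\epsilon=\left|\frac g\gamma+c\right|$, and let $U=\operatorname{Im}W$ be the profile of a solitary wave of velocity $c$, that is, a real-valued even function with $U,\ \alpha U\in H^2(\mathbb R)$ solving the Babenko equation $$(g+c\gamma-c^2|D|)U=-\tfrac{\gamma^2}{2}U^2-gU|D|U-\tfrac g2|D|U^2+\tfrac{\gamma^2}{2}\Big(U|D|U^2-U^2|D|U-\tfrac13|D|U^3\Big).$$ Then there are real numbers $b_1,b_2,\dots$ such that for every $N\ge1$ $$U(\alpha)=\sum_{k=1}^N b_k\,\rho^k\!\left(\frac{\epsilon\alpha}{(1+\epsilon)^2}\right)+g_N(\alpha),\qquad g_N\in H^{2,2N},\qquad g_N(\alpha)=o(\langle\alpha\rangle^{-2N})\ \text{ as } |\alpha|\to\infty.$$ In both cases, writing $f$ for $\phi$ or $U$: only even powers of $\langle\alpha\rangle^{-1}$ appear, in the sense that there are real numbers $d_1,d_2,\dots$ with $f-\sum_{k=1}^N d_k\langle\alpha\rangle^{-2k}\in H^{2,2N}$ for every $N\ge1$; and $f(\alpha)=O\big((1+\alpha^2)^{-1}\big)$. -/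

import Mathlib

open MeasureTheory Filter Topology Asymptotics
open scoped FourierTransform SchwartzMap

/-- The Benjamin–Ono soliton `ρ(x) = 4 / (1 + x²)`. -/
noncomputable def rho (x : ℝ) : ℝ := 4 / (1 + x ^ 2)

/-- The Japanese bracket `⟨α⟩ = (1 + α²)^{1/2}`. -/
noncomputable def bracket (α : ℝ) : ℝ := Real.sqrt (1 + α ^ 2)

/-- `f ∈ H^s(ℝ)` for a real-valued function `f` on the line and `s ≥ 0`: `f` is square integrable
and the tempered distribution it defines lies in the `L²`-based Sobolev space of order `s`. -/
def MemH (s : ℝ) (f : ℝ → ℝ) : Prop :=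
  ∃ F : Lp ℂ 2 (volume : Measure ℝ),
    (F =ᵐ[volume] fun x => (f x : ℂ)) ∧ TemperedDistribution.MemSobolev s 2 (F : 𝓢'(ℝ, ℂ))

/-- The weighted Sobolev space `H^{s,σ} = {f : ⟨α⟩^σ f ∈ H^s}`. -/
def MemHWeighted (s σ : ℝ) (f : ℝ → ℝ) : Prop :=
  MemH s (fun α => bracket α ^ σ * f α)

/-- `IsAbsD f h` says that `f, h ∈ L²(ℝ)` and `h = |D| f` (as elements of `L²`), where `|D|` is the
Fourier multiplier with symbol the absolute value of the frequency. The `L²` Fourier transform is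
normalised by the kernel `exp (-2πixξ)`, so that the symbol reads `2π|ξ|`. -/
def IsAbsD (f h : ℝ → ℝ) : Prop :=
  ∃ F G : Lp ℂ 2 (volume : Measure ℝ),
    (F =ᵐ[volume] fun x => (f x : ℂ)) ∧ (G =ᵐ[volume] fun x => (h x : ℂ)) ∧
    ((𝓕 G : Lp ℂ 2 (volume : Measure ℝ)) =ᵐ[volume]
      fun ξ => ((2 * Real.pi * |ξ| : ℝ) : ℂ) * (𝓕 F : Lp ℂ 2 (volume : Measure ℝ)) ξ)

/-- The class of profiles: even functions `f` with `f ∈ H²` and `α f ∈ H²`, each represented by its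
continuous representative (elements of `H²(ℝ)` have exactly one). -/
structure IsEvenLocalizedH2 (f : ℝ → ℝ) : Prop where
  continuous : Continuous f
  even : ∀ α, f (-α) = f α
  memH : MemH 2 f
  memH_mul : MemH 2 (fun α => α * f α)

/-- The Babenko equation for the profile `U = Im W` of a solitary wave of velocity `c`, with gravity
`g` and vorticity `γ`:
`(g + cγ - c²|D|) U = -γ²/2 U² - g U |D|U - g/2 |D|U²
  + γ²/2 (U |D|U² - U² |D|U - 1/3 |D|U³)`. Here `d₁, d₂, d₃` are `|D|U`, `|D|U²`, `|D|U³`. -/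
def SolvesBabenko (g γ c : ℝ) (U : ℝ → ℝ) : Prop :=
  ∃ d₁ d₂ d₃ : ℝ → ℝ,
    IsAbsD U d₁ ∧ IsAbsD (fun α => U α ^ 2) d₂ ∧ IsAbsD (fun α => U α ^ 3) d₃ ∧
    ∀ᵐ α ∂(volume : Measure ℝ),
      (g + c * γ) * U α - c ^ 2 * d₁ α =
        -(γ ^ 2 / 2) * U α ^ 2 - g * (U α * d₁ α) - g / 2 * d₂ α
          + γ ^ 2 / 2 * (U α * d₂ α - U α ^ 2 * d₁ α - 1 / 3 * d₃ α)

/-- The rescaled Babenko equation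
`-φ - |D|φ + 1/2 φ² = ε/(1+ε)² (-φ |D|φ - 1/2 |D|φ²)
  + ε²/(1+ε)² (1/2 φ |D|φ² - 1/2 φ² |D|φ - 1/6 |D|φ³)`.
Here `d₁, d₂, d₃` are `|D|φ`, `|D|φ²`, `|D|φ³`. -/
def SolvesRescaledBabenko (ε : ℝ) (φ : ℝ → ℝ) : Prop :=
  ∃ d₁ d₂ d₃ : ℝ → ℝ,
    IsAbsD φ d₁ ∧ IsAbsD (fun α => φ α ^ 2) d₂ ∧ IsAbsD (fun α => φ α ^ 3) d₃ ∧
    ∀ᵐ α ∂(volume : Measure ℝ),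
      -φ α - d₁ α + 1 / 2 * φ α ^ 2 =
        ε / (1 + ε) ^ 2 * (-(φ α * d₁ α) - 1 / 2 * d₂ α)
          + ε ^ 2 / (1 + ε) ^ 2 *
            (1 / 2 * (φ α * d₂ α) - 1 / 2 * (φ α ^ 2 * d₁ α) - 1 / 6 * d₃ α)

/-! ### The `L²` Fourier transform and the inverse Fourier integral -/

section FourierL2

/-! Decay of a profile is smoothness of its Fourier transform. Write the profile as `𝓕⁻ k`. Both
equations have the form `A φ + B |D| φ = N(φ)` with `A, B > 0` and `N` made of quadratic and cubic
terms, so on the Fourier side `k = (A + 2πB|ξ|)⁻¹ Q`, where `Q` is built from convolutions of `k`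
and factors `|ξ|`. The factor `|ξ|` is singular only at the origin, so the best to be hoped for is
that `k` is smooth on each half-line, with jumps of its derivatives at `0`. `JumpSmooth` encodes
this.

A bootstrap proves it. Convolving two functions with `n + 1` such derivatives gives one with `n + 2`
(`JumpSmooth.conv_gain`): a jump at the origin contributes a multiple of a delta, which merely
reproduces the other factor (`conv_jumpPrim`). Each `|ξ|` costs one power of the weight, which the
resolvent returns (`JumpSmooth.resolventSymbol_mul`). The hypothesis that `αφ` is in `H²` supplies
the first derivative, and `jumpSmooth_of_equation` then reaches every order.

The expansion comes from the jumps. Two integrations by parts express `4π²α² u(α)` through the jumps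
of `k` and `k'` at `0`; evenness removes the first. Hence `(1 + (λα)²) u = c + v` with `v` in the
same class (`IsEvenJumpSmooth.exists_mul_eq`). Iteration gives a series in powers of `(1 +
(λα)²)⁻¹`, whose remainder is controlled by `H²` membership and the Riemann–Lebesgue lemma. Choosing
`λ` gives powers of the soliton at the required scale, or of the bracket. -/

theorem ae_eq_of_integral_schwartz_mul_eq {f f' : ℝ → ℂ} (hf : LocallyIntegrable f)
    (hf' : LocallyIntegrable f')
    (h : ∀ g : 𝓢(ℝ, ℂ), ∫ x, g x * f x = ∫ x, g x * f' x) : f =ᵐ[volume] f' := by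
  apply ae_eq_of_integral_contDiff_smul_eq hf hf'
  intro g g_smooth g_cpt
  have hg₁ : HasCompactSupport (Complex.ofRealCLM ∘ g) := g_cpt.comp_left rfl
  have hg₂ : ContDiff ℝ (↑(⊤ : ℕ∞)) (Complex.ofRealCLM ∘ g) := by fun_prop
  simpa using h (hg₁.toSchwartzMap hg₂)

theorem integral_fourierInv_mul_eq {f g : ℝ → ℂ} (hf : Integrable f) (hg : Integrable g) :
    ∫ x, 𝓕⁻ f x * g x = ∫ x, f x * 𝓕⁻ g x := by
  have := VectorFourier.integral_fourierIntegral_smul_eq_flip (μ := volume) (ν := volume)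
    (L := innerₗ ℝ) Real.continuous_fourierChar continuous_inner hf hg.comp_neg
  rw [← integral_neg_eq_self] at this
  simp only [Real.fourierInv_eq_fourier_neg]
  convert this using 1
  · simp; rfl
  · congr 1; ext x
    simp only [smul_eq_mul, flip_innerₗ]
    congr 1
    change 𝓕 g (-x) = 𝓕 (fun y => g (-y)) x
    rw [← Real.fourierInv_eq_fourier_neg, Real.fourierInv_eq_fourier_comp_neg]

theorem continuous_fourierInv {k : ℝ → ℂ} (hk : Integrable k) : Continuous (𝓕⁻ k) := by
  have : 𝓕⁻ k = 𝓕 (fun y => k (-y)) := by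
    ext x; rw [Real.fourierInv_eq_fourier_comp_neg]
  rw [this]
  exact VectorFourier.fourierIntegral_continuous Real.continuous_fourierChar
    (L := innerₗ ℝ) continuous_inner hk.comp_neg

theorem tendsto_fourierInv_cocompact (k : ℝ → ℂ) : Tendsto (𝓕⁻ k) (cocompact ℝ) (𝓝 0) := by
  have : 𝓕⁻ k = 𝓕 (fun y => k (-y)) := by
    ext x; rw [Real.fourierInv_eq_fourier_comp_neg]
  rw [this]
  exact Real.zero_at_infty_fourier _

/-- Both sides pair identically with Schwartz functions. This links the abstract `L²` transform used
in `MemH` and `IsAbsD` to an integral that can be evaluated pointwise. -/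
theorem Lp.coeFn_fourierInv_ae_eq (F : Lp ℂ 2 (volume : Measure ℝ)) {k : ℝ → ℂ}
    (hk : Integrable k) (h : F =ᵐ[volume] k) :
    ((𝓕⁻ F : Lp ℂ 2 (volume : Measure ℝ)) : ℝ → ℂ) =ᵐ[volume] 𝓕⁻ k := by
  apply ae_eq_of_integral_schwartz_mul_eq
  · exact (Lp.memLp _).locallyIntegrable one_le_two
  · exact (continuous_fourierInv hk).locallyIntegrable
  intro g
  have h1 := congrArg (fun T : 𝓢'(ℝ, ℂ) => T g) (Lp.fourierInv_toTemperedDistribution_eq F)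
  simp only [TemperedDistribution.fourierInv_apply, Lp.toTemperedDistribution_apply,
    smul_eq_mul] at h1
  rw [← h1, ← integral_fourierInv_mul_eq g.integrable hk]
  apply integral_congr_ae
  filter_upwards [h] with x hx
  rw [hx, SchwartzMap.fourierInv_coe]

/-- The `L²` Fourier transform inverts the inverse Fourier integral on `L¹ ∩ L²`. -/
theorem Lp.coeFn_fourier_ae_eq (F : Lp ℂ 2 (volume : Measure ℝ)) {k : ℝ → ℂ}
    (hk : Integrable k) (hk2 : MemLp k 2) (h : F =ᵐ[volume] 𝓕⁻ k) :
    ((𝓕 F : Lp ℂ 2 (volume : Measure ℝ)) : ℝ → ℂ) =ᵐ[volume] k := by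
  have h1 := Lp.coeFn_fourierInv_ae_eq (hk2.toLp k) hk hk2.coeFn_toLp
  have h2 : F = 𝓕⁻ (hk2.toLp k) := by
    apply Lp.ext
    exact h.trans h1.symm
  rw [h2, FourierTransform.fourier_fourierInv_eq]
  exact hk2.coeFn_toLp

theorem fourierInv_memLp_two {k : ℝ → ℂ} (hk : Integrable k) (hk2 : MemLp k 2) :
    MemLp (𝓕⁻ k) 2 :=
  (memLp_congr_ae (Lp.coeFn_fourierInv_ae_eq (hk2.toLp k) hk hk2.coeFn_toLp)).1 (Lp.memLp _)

theorem ae_eq_of_fourierInv_ae_eq {k l : ℝ → ℂ} (hk : Integrable k) (hk2 : MemLp k 2)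
    (hl : Integrable l) (hl2 : MemLp l 2) (h : 𝓕⁻ k =ᵐ[volume] 𝓕⁻ l) : k =ᵐ[volume] l := by
  have h0 := fourierInv_memLp_two hk hk2
  have h1 := Lp.coeFn_fourier_ae_eq (h0.toLp _) hk hk2 h0.coeFn_toLp
  have h2 := Lp.coeFn_fourier_ae_eq (h0.toLp _) hl hl2 (h0.coeFn_toLp.trans h)
  exact h1.symm.trans h2

theorem memSobolev_two_iff (F : Lp ℂ 2 (volume : Measure ℝ)) :
    TemperedDistribution.MemSobolev 2 2 (F : 𝓢'(ℝ, ℂ)) ↔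
      MemLp (fun ξ : ℝ => ((1 + ξ ^ 2 : ℝ) : ℂ) * (𝓕 F : Lp ℂ 2 (volume : Measure ℝ)) ξ) 2 := by
  rw [TemperedDistribution.memSobolev_iff_exists_smulLeftCLM_fourier,
    Lp.fourier_toTemperedDistribution_eq]
  have hw : (fun x : ℝ ↦ (((1 + ‖x‖ ^ 2) ^ ((2 : ℝ) / 2) : ℝ) : ℂ))
      = fun x : ℝ => ((1 + x ^ 2 : ℝ) : ℂ) := by
    ext x; simp
  rw [hw]
  have hg : (fun x : ℝ => ((1 + x ^ 2 : ℝ) : ℂ)).HasTemperateGrowth := by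
    rw [← hw]; fun_prop
  have key : ∀ (G : Lp ℂ 2 (volume : Measure ℝ)) (u : 𝓢(ℝ, ℂ)),
      (TemperedDistribution.smulLeftCLM ℂ (fun x : ℝ => ((1 + x ^ 2 : ℝ) : ℂ)) (G : 𝓢'(ℝ, ℂ))) u
        = ∫ x, u x * (((1 + x ^ 2 : ℝ) : ℂ) * G x) := by
    intro G u
    rw [TemperedDistribution.smulLeftCLM_apply_apply, Lp.toTemperedDistribution_apply]
    congr 1; ext x
    rw [SchwartzMap.smulLeftCLM_apply_apply hg]
    simp only [smul_eq_mul]; ring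
  constructor
  · rintro ⟨f', hf'⟩
    refine (memLp_congr_ae ?_).2 (Lp.memLp f')
    apply ae_eq_of_integral_schwartz_mul_eq
    · exact ((Lp.memLp (𝓕 F)).locallyIntegrable one_le_two).continuous_mul (by fun_prop)
    · exact (Lp.memLp _).locallyIntegrable one_le_two
    · intro g
      rw [← key, hf', Lp.toTemperedDistribution_apply]; rfl
  · intro h
    refine ⟨h.toLp _, ?_⟩
    ext u
    rw [key, Lp.toTemperedDistribution_apply]
    apply integral_congr_ae
    filter_upwards [h.coeFn_toLp] with x hx
    rw [hx]; rfl

end FourierL2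

/-! ### Weighted `L²` spaces and convolution -/

section Weighted

/-- `⟨ξ⟩^s k ∈ L²`, with the weight `(1 + |ξ|)^s`. -/
def WeightedL2 (s : ℕ) (k : ℝ → ℂ) : Prop :=
  MemLp (fun ξ : ℝ => (((1 + |ξ|) ^ s : ℝ) : ℂ) * k ξ) 2

theorem norm_weight (s : ℕ) (ξ : ℝ) : ‖(((1 + |ξ|) ^ s : ℝ) : ℂ)‖ = (1 + |ξ|) ^ s := by
  rw [Complex.norm_real, Real.norm_of_nonneg (by positivity)]

theorem weight_ne_zero (s : ℕ) (ξ : ℝ) : (((1 + |ξ|) ^ s : ℝ) : ℂ) ≠ 0 := by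
  have : (1 + |ξ|) ^ s ≠ 0 := by positivity
  exact_mod_cast this

theorem continuous_weight (s : ℕ) : Continuous fun ξ : ℝ => (((1 + |ξ|) ^ s : ℝ) : ℂ) := by
  fun_prop

namespace WeightedL2

variable {s t : ℕ} {k l : ℝ → ℂ}

theorem aestronglyMeasurable (hk : WeightedL2 s k) : AEStronglyMeasurable k volume := by
  have h1 : AEStronglyMeasurable (fun ξ : ℝ => ((((1 + |ξ|) ^ s : ℝ) : ℂ))⁻¹) volume :=
    ((continuous_weight s).inv₀ (weight_ne_zero s)).aestronglyMeasurable
  refine (h1.mul hk.1).congr (ae_of_all _ fun ξ => ?_)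
  exact inv_mul_cancel_left₀ (weight_ne_zero s ξ) _

theorem congr (hk : WeightedL2 s k) (h : k =ᵐ[volume] l) : WeightedL2 s l := by
  refine (memLp_congr_ae ?_).1 hk
  filter_upwards [h] with x hx
  rw [hx]

theorem add (hk : WeightedL2 s k) (hl : WeightedL2 s l) :
    WeightedL2 s (fun ξ => k ξ + l ξ) := by
  refine (memLp_congr_ae (ae_of_all _ fun ξ => ?_)).1 (MemLp.add hk hl)
  simp [mul_add]

/-- Multiplication by a function of controlled growth. -/
theorem mul_left (hk : WeightedL2 s k) {M : ℝ → ℂ} (hM : AEStronglyMeasurable M volume) (C : ℝ)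
    (h : ∀ ξ, (1 + |ξ|) ^ t * ‖M ξ‖ ≤ C * (1 + |ξ|) ^ s) : WeightedL2 t (fun ξ => M ξ * k ξ) := by
  refine MemLp.of_le_mul (c := C) hk ?_ (ae_of_all _ fun ξ => ?_)
  · exact (continuous_weight t).aestronglyMeasurable.mul (hM.mul hk.aestronglyMeasurable)
  · rw [norm_mul, norm_mul, norm_mul, norm_weight, norm_weight, ← mul_assoc, ← mul_assoc]
    exact mul_le_mul_of_nonneg_right (h ξ) (norm_nonneg _)

theorem const_mul (hk : WeightedL2 s k) (c : ℂ) : WeightedL2 s (fun ξ => c * k ξ) :=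
  hk.mul_left aestronglyMeasurable_const ‖c‖ fun ξ => by rw [mul_comm]

theorem mono (hk : WeightedL2 s k) (h : t ≤ s) : WeightedL2 t k := by
  simpa using hk.mul_left (M := fun _ => 1) (t := t) aestronglyMeasurable_const 1 fun ξ => by
    simpa using pow_le_pow_right₀ (by linarith [abs_nonneg ξ]) h

theorem memLp (hk : WeightedL2 s k) : MemLp k 2 := by
  simpa [WeightedL2] using hk.mono (Nat.zero_le s)

theorem integrable (hk : WeightedL2 1 k) : Integrable k := by
  have h1 : MemLp (fun ξ : ℝ => ((((1 + |ξ|) ^ 1 : ℝ) : ℂ))⁻¹) 2 := by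
    have hm : AEStronglyMeasurable (fun ξ : ℝ => ((((1 + |ξ|) ^ 1 : ℝ) : ℂ))⁻¹) volume :=
      ((continuous_weight 1).inv₀ (weight_ne_zero 1)).aestronglyMeasurable
    rw [memLp_two_iff_integrable_sq_norm hm]
    refine (integrable_inv_one_add_sq).mono' (by fun_prop) (ae_of_all _ fun ξ => ?_)
    rw [norm_inv, norm_weight, Real.norm_of_nonneg (by positivity), inv_pow]
    apply inv_anti₀ (by positivity)
    nlinarith [abs_nonneg ξ, sq_abs ξ]
  have h2 : Integrable (fun ξ : ℝ => ((((1 + |ξ|) ^ 1 : ℝ) : ℂ))⁻¹ *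
      ((((1 + |ξ|) ^ 1 : ℝ) : ℂ) * k ξ)) := h1.integrable_mul hk
  refine h2.congr (ae_of_all _ fun ξ => ?_)
  exact inv_mul_cancel_left₀ (weight_ne_zero 1 ξ) _

theorem integrable_of_le (hk : WeightedL2 s k) (hs : 1 ≤ s) : Integrable k :=
  (hk.mono hs).integrable

theorem comp_neg (hk : WeightedL2 s k) : WeightedL2 s (fun ξ => k (-ξ)) := by
  have := MemLp.comp_measurePreserving hk (Measure.measurePreserving_neg volume)
  refine (memLp_congr_ae (ae_of_all _ fun ξ => ?_)).1 this
  simp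

theorem star (hk : WeightedL2 s k) : WeightedL2 s (fun ξ => (starRingEnd ℂ) (k ξ)) := by
  refine MemLp.of_le hk ?_ (ae_of_all _ fun ξ => ?_)
  · exact (continuous_weight s).aestronglyMeasurable.mul
      (Complex.continuous_conj.comp_aestronglyMeasurable hk.aestronglyMeasurable)
  · rw [norm_mul, norm_mul, RCLike.norm_conj]

end WeightedL2

open scoped ENNReal in
-- Young's inequality `L¹ * L² ⊆ L²`: apply Cauchy–Schwarz to `f g = f^{1/2} (f g²)^{1/2}`, then
-- Tonelli and translation invariance.
theorem lintegral_lconvolution_sq_le {f g : ℝ → ℝ≥0∞} (hf : AEMeasurable f)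
    (hg : AEMeasurable g) :
    ∫⁻ x, (∫⁻ t, f t * g (x - t)) ^ (2 : ℝ) ≤ (∫⁻ x, f x) ^ (2 : ℝ) * ∫⁻ x, g x ^ (2 : ℝ) := by
  have hgx : ∀ x : ℝ, AEMeasurable (fun t => g (x - t)) := fun x =>
    hg.comp_quasiMeasurePreserving (quasiMeasurePreserving_sub_left_of_right_invariant volume x)
  have hprod : AEMeasurable (Function.uncurry fun x t : ℝ => f t * g (x - t) ^ (2 : ℝ))
      (volume.prod volume) := by
    refine (hf.comp_snd).mul (AEMeasurable.pow_const ?_ _)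
    exact hg.comp_quasiMeasurePreserving
      (quasiMeasurePreserving_sub_of_right_invariant volume volume)
  have h1 : ∀ x, (∫⁻ t, f t * g (x - t)) ^ (2 : ℝ)
      ≤ (∫⁻ t, f t) * ∫⁻ t, f t * g (x - t) ^ (2 : ℝ) := by
    intro x
    have h := ENNReal.lintegral_mul_norm_pow_le (μ := volume) hf
      (hf.mul ((hgx x).pow_const (2 : ℝ))) (p := 1 / 2) (q := 1 / 2)
      (by norm_num) (by norm_num) (by norm_num)
    have e : ∀ t, f t ^ (1 / 2 : ℝ) * (f t * g (x - t) ^ (2 : ℝ)) ^ (1 / 2 : ℝ)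
        = f t * g (x - t) := by
      intro t
      rw [← ENNReal.mul_rpow_of_nonneg _ _ (by norm_num), ← mul_assoc, ← pow_two,
        ← ENNReal.rpow_natCast, Nat.cast_ofNat, ← ENNReal.mul_rpow_of_nonneg _ _ (by norm_num),
        ← ENNReal.rpow_mul]
      norm_num
    simp only [Pi.mul_apply, e] at h
    calc _ ≤ ((∫⁻ t, f t) ^ (1 / 2 : ℝ) *
          (∫⁻ t, f t * g (x - t) ^ (2 : ℝ)) ^ (1 / 2 : ℝ)) ^ (2 : ℝ) :=
          ENNReal.rpow_le_rpow h (by norm_num)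
      _ = _ := by
        rw [ENNReal.mul_rpow_of_nonneg _ _ (by norm_num), ← ENNReal.rpow_mul, ← ENNReal.rpow_mul]
        norm_num
  calc _ ≤ ∫⁻ x, (∫⁻ t, f t) * ∫⁻ t, f t * g (x - t) ^ (2 : ℝ) := lintegral_mono h1
    _ = (∫⁻ t, f t) * ∫⁻ x, ∫⁻ t, f t * g (x - t) ^ (2 : ℝ) :=
        lintegral_const_mul'' _ hprod.lintegral_prod_right'
    _ = (∫⁻ t, f t) * ∫⁻ t, ∫⁻ x, f t * g (x - t) ^ (2 : ℝ) := by
        rw [lintegral_lintegral_swap hprod]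
    _ = (∫⁻ t, f t) * ∫⁻ t, f t * ∫⁻ x, g x ^ (2 : ℝ) := by
        congr 1
        apply lintegral_congr
        intro t
        rw [lintegral_const_mul'', lintegral_sub_right_eq_self (fun x => g x ^ (2 : ℝ))]
        exact (hg.comp_quasiMeasurePreserving
          (measurePreserving_sub_right volume t).quasiMeasurePreserving).pow_const _
    _ = _ := by
        rw [lintegral_mul_const'' _ hf, ← mul_assoc]
        congr 1
        rw [← pow_two, ← ENNReal.rpow_natCast]; norm_num

/-- Convolution of complex-valued functions on the line. -/
noncomputable def conv (k l : ℝ → ℂ) : ℝ → ℂ :=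
  MeasureTheory.convolution k l (ContinuousLinearMap.mul ℂ ℂ) volume

theorem conv_apply (k l : ℝ → ℂ) (x : ℝ) : conv k l x = ∫ t, k t * l (x - t) := rfl

theorem conv_comm (k l : ℝ → ℂ) : conv k l = conv l k := by
  ext x
  rw [conv_apply, conv_apply, ← integral_sub_left_eq_self (fun t => k t * l (x - t)) volume x]
  simp [mul_comm]

theorem integrable_conv {k l : ℝ → ℂ} (hk : Integrable k) (hl : Integrable l) :
    Integrable (conv k l) :=
  hk.integrable_convolution _ hl

theorem fourierInv_conv {k l : ℝ → ℂ} (hk : Integrable k) (hl : Integrable l) (x : ℝ) :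
    𝓕⁻ (conv k l) x = 𝓕⁻ k x * 𝓕⁻ l x := by
  simp only [Real.fourierInv_eq_fourier_neg]
  exact Real.fourier_mul_convolution_eq hk hl _

theorem lconvolution_comm (f g : ℝ → ENNReal) (x : ℝ) :
    ∫⁻ t, f t * g (x - t) = ∫⁻ t, g t * f (x - t) := by
  rw [← lintegral_sub_left_eq_self (fun t => f t * g (x - t)) x]
  simp [mul_comm]

/-- The weight at `x` is dominated by the sum of the weights at `t` and `x - t`, so it can be placed
on one factor; the other factor is in `L¹` because `s ≥ 1`, and Young's inequality applies. -/
theorem WeightedL2.conv {s : ℕ} {k l : ℝ → ℂ} (hs : 1 ≤ s) (hk : WeightedL2 s k)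
    (hl : WeightedL2 s l) : WeightedL2 s (conv k l) := by
  have hki := hk.integrable_of_le hs
  have hli := hl.integrable_of_le hs
  set w : ℝ → ℂ := fun ξ => (((1 + |ξ|) ^ s : ℝ) : ℂ) with hw
  set K : ℝ → ENNReal := fun ξ => ‖k ξ‖ₑ
  set Λ : ℝ → ENNReal := fun ξ => ‖l ξ‖ₑ
  set wK : ℝ → ENNReal := fun ξ => ‖w ξ * k ξ‖ₑ
  set wΛ : ℝ → ENNReal := fun ξ => ‖w ξ * l ξ‖ₑ
  have mK : AEMeasurable K := hki.1.enorm
  have mΛ : AEMeasurable Λ := hli.1.enorm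
  have mwK : AEMeasurable wK := hk.1.enorm
  have mwΛ : AEMeasurable wΛ := hl.1.enorm
  have hsub : ∀ x : ℝ, ∀ {f : ℝ → ENNReal}, AEMeasurable f → AEMeasurable (fun t => f (x - t)) :=
    fun x f hf => hf.comp_quasiMeasurePreserving
      (quasiMeasurePreserving_sub_left_of_right_invariant volume x)
  have hpt : ∀ x, ‖w x * _root_.conv k l x‖ₑ ≤
      2 ^ (s - 1) * ((∫⁻ t, Λ t * wK (x - t)) + ∫⁻ t, K t * wΛ (x - t)) := by
    intro x
    rw [conv_apply, ← integral_const_mul, lconvolution_comm Λ wK, ← lintegral_add_left',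
      ← lintegral_const_mul'']
    · refine (enorm_integral_le_lintegral_enorm _).trans (lintegral_mono fun t => ?_)
      have h1 : ‖w x‖ ≤ 2 ^ (s - 1) * (‖w t‖ + ‖w (x - t)‖) := by
        simp only [hw, norm_weight]
        calc (1 + |x|) ^ s ≤ ((1 + |t|) + (1 + |x - t|)) ^ s := by
              have := abs_add_le t (x - t)
              rw [add_sub_cancel] at this
              exact pow_le_pow_left₀ (by positivity) (by linarith) s
          _ ≤ _ := add_pow_le (by positivity) (by positivity) s
      have h2 : ‖w x‖ₑ ≤ 2 ^ (s - 1) * (‖w t‖ₑ + ‖w (x - t)‖ₑ) := by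
        have := ENNReal.ofReal_le_ofReal h1
        rw [ENNReal.ofReal_mul (by positivity), ENNReal.ofReal_add (norm_nonneg _) (norm_nonneg _),
          ENNReal.ofReal_pow (by norm_num)] at this
        simpa only [ofReal_norm, ENNReal.ofReal_ofNat] using this
      simp only [K, Λ, wK, wΛ, enorm_mul]
      calc _ ≤ 2 ^ (s - 1) * (‖w t‖ₑ + ‖w (x - t)‖ₑ) * (‖k t‖ₑ * ‖l (x - t)‖ₑ) := by gcongr
        _ = _ := by ring
    · exact (mwK.mul (hsub x mΛ)).add (mK.mul (hsub x mwΛ))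
    · exact mwK.mul (hsub x mΛ)
  refine ⟨(continuous_weight s).aestronglyMeasurable.mul (integrable_conv hki hli).1, ?_⟩
  rw [eLpNorm_lt_top_iff_lintegral_rpow_enorm_lt_top (by norm_num) (by norm_num)]
  simp only [ENNReal.toReal_ofNat]
  have hL2 : ∀ {f : ℝ → ℂ}, MemLp f 2 → ∫⁻ x, ‖f x‖ₑ ^ (2 : ℝ) < ⊤ := fun {f} hf => by
    simpa using (eLpNorm_lt_top_iff_lintegral_rpow_enorm_lt_top (by norm_num) (by norm_num)).1 hf.2
  have hA : ∫⁻ x, (∫⁻ t, Λ t * wK (x - t)) ^ (2 : ℝ) < ⊤ :=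
    (lintegral_lconvolution_sq_le mΛ mwK).trans_lt (ENNReal.mul_lt_top
      (ENNReal.rpow_lt_top_of_nonneg (by norm_num) hli.2.ne) (hL2 hk))
  have hB : ∫⁻ x, (∫⁻ t, K t * wΛ (x - t)) ^ (2 : ℝ) < ⊤ :=
    (lintegral_lconvolution_sq_le mK mwΛ).trans_lt (ENNReal.mul_lt_top
      (ENNReal.rpow_lt_top_of_nonneg (by norm_num) hki.2.ne) (hL2 hl))
  have mA : AEMeasurable fun x : ℝ => (∫⁻ t, Λ t * wK (x - t)) ^ (2 : ℝ) := by
    refine AEMeasurable.pow_const (AEMeasurable.lintegral_prod_right'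
      (f := fun p : ℝ × ℝ => Λ p.2 * wK (p.1 - p.2)) ?_) _
    exact mΛ.comp_snd.mul (mwK.comp_quasiMeasurePreserving
      (quasiMeasurePreserving_sub_of_right_invariant volume volume))
  have h2top : ((2 : ENNReal) ^ (s - 1)) ^ (2 : ℝ) ≠ ⊤ :=
    ENNReal.rpow_ne_top_of_nonneg (by norm_num) (ENNReal.pow_ne_top (by norm_num))
  calc _ ≤ ∫⁻ x, ((2 : ENNReal) ^ (s - 1)) ^ (2 : ℝ) * (2 ^ ((2 : ℝ) - 1) *
        ((∫⁻ t, Λ t * wK (x - t)) ^ (2 : ℝ) + (∫⁻ t, K t * wΛ (x - t)) ^ (2 : ℝ))) := by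
        refine lintegral_mono fun x => ?_
        refine (ENNReal.rpow_le_rpow (hpt x) (by norm_num)).trans ?_
        rw [ENNReal.mul_rpow_of_nonneg _ _ (by norm_num)]
        gcongr
        exact ENNReal.rpow_add_le_mul_rpow_add_rpow _ _ (by norm_num)
    _ = ((2 : ENNReal) ^ (s - 1)) ^ (2 : ℝ) * (2 ^ ((2 : ℝ) - 1) *
        ((∫⁻ x, (∫⁻ t, Λ t * wK (x - t)) ^ (2 : ℝ)) +
          ∫⁻ x, (∫⁻ t, K t * wΛ (x - t)) ^ (2 : ℝ))) := by
        rw [lintegral_const_mul' _ _ h2top, lintegral_const_mul' _ _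
          (ENNReal.rpow_ne_top_of_nonneg (by norm_num) (by norm_num)), lintegral_add_left' mA]
    _ < ⊤ := ENNReal.mul_lt_top h2top.lt_top (ENNReal.mul_lt_top
        (ENNReal.rpow_lt_top_of_nonneg (by norm_num) (by norm_num)) (ENNReal.add_lt_top.2 ⟨hA, hB⟩))

end Weighted

/-! ### Primitives with a jump at the origin -/

section Primitive

/-- The kernel of the primitive `jumpPrim`. -/
noncomputable def jumpKernel (x t : ℝ) : ℂ := (if t ≤ x then 1 else 0) - (if 0 < x then 1 else 0)

/-- The primitive on `ℝ \ {0}` vanishing at `±∞`: `-∫_x^∞ f` for `x > 0`, and `∫_{-∞}^x f` for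
`x ≤ 0`. -/
noncomputable def jumpPrim (f : ℝ → ℂ) (x : ℝ) : ℂ := ∫ t, jumpKernel x t * f t

theorem jumpKernel_of_pos {x : ℝ} (hx : 0 < x) (t : ℝ) :
    jumpKernel x t = if x < t then -1 else 0 := by
  unfold jumpKernel; split_ifs <;> first | linarith | norm_num

theorem jumpKernel_of_nonpos {x : ℝ} (hx : x ≤ 0) (t : ℝ) :
    jumpKernel x t = if t ≤ x then 1 else 0 := by
  unfold jumpKernel; split_ifs <;> first | linarith | norm_num

theorem norm_jumpKernel_le (x t : ℝ) : ‖jumpKernel x t‖ ≤ 1 := by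
  unfold jumpKernel; split_ifs <;> norm_num

/-- For fixed `t` the support in `x` has length at most `2|t|`. This is why pairing with a merely
bounded multiplier requires the moment `|t| f(t)` to be integrable. -/
theorem norm_jumpKernel_le_indicator (x t : ℝ) :
    ‖jumpKernel x t‖ ≤ (Set.Icc (-|t|) |t|).indicator (fun _ => (1 : ℝ)) x := by
  by_cases h : x ∈ Set.Icc (-|t|) |t|
  · rw [Set.indicator_of_mem h]; exact norm_jumpKernel_le x t
  · rw [Set.indicator_of_notMem h]
    have : jumpKernel x t = 0 := by
      rw [Set.mem_Icc, not_and_or, not_le, not_le] at h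
      rcases le_or_gt x 0 with hx | hx
      · rw [jumpKernel_of_nonpos hx, if_neg]
        intro h'
        have := neg_abs_le t; have := neg_le_abs t; have := abs_nonneg t
        rcases h with h | h <;> linarith
      · rw [jumpKernel_of_pos hx, if_neg]
        intro h'
        have := le_abs_self t; have := abs_nonneg t
        rcases h with h | h <;> linarith
    simp [this]

theorem measurable_jumpKernel : Measurable fun p : ℝ × ℝ => jumpKernel p.1 p.2 := by
  unfold jumpKernel
  refine Measurable.sub (Measurable.ite (measurableSet_le measurable_snd measurable_fst)
    measurable_const measurable_const) (Measurable.ite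
    (measurableSet_lt measurable_const measurable_fst) measurable_const measurable_const)

theorem integrable_jumpKernel_mul {f : ℝ → ℂ} (hf : Integrable f) (x : ℝ) :
    Integrable fun t => jumpKernel x t * f t :=
  hf.bdd_mul (measurable_jumpKernel.comp measurable_prodMk_left).aestronglyMeasurable
    (c := 1) (ae_of_all _ fun t => norm_jumpKernel_le x t)

theorem jumpPrim_congr {f g : ℝ → ℂ} (h : f =ᵐ[volume] g) : jumpPrim f = jumpPrim g := by
  ext x
  apply integral_congr_ae
  filter_upwards [h] with t ht
  rw [ht]

theorem jumpPrim_add {f g : ℝ → ℂ} (hf : Integrable f) (hg : Integrable g) (x : ℝ) :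
    jumpPrim (fun t => f t + g t) x = jumpPrim f x + jumpPrim g x := by
  unfold jumpPrim
  rw [← integral_add (integrable_jumpKernel_mul hf x) (integrable_jumpKernel_mul hg x)]
  simp only [mul_add]

theorem jumpPrim_const_mul (c : ℂ) (f : ℝ → ℂ) (x : ℝ) :
    jumpPrim (fun t => c * f t) x = c * jumpPrim f x := by
  unfold jumpPrim
  rw [← integral_const_mul]
  congr 1; ext t; ring

theorem norm_jumpPrim_le (f : ℝ → ℂ) (x : ℝ) (hf : Integrable f) :
    ‖jumpPrim f x‖ ≤ ∫ t, ‖f t‖ := by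
  refine norm_integral_le_of_norm_le hf.norm (ae_of_all _ fun t => ?_)
  rw [norm_mul]
  exact mul_le_of_le_one_left (norm_nonneg _) (norm_jumpKernel_le x t)

theorem jumpPrim_eq {f : ℝ → ℂ} (hf : Integrable f) (x : ℝ) :
    jumpPrim f x = (∫ t in Set.Iic x, f t) - if 0 < x then ∫ t, f t else 0 := by
  have h1 : ∀ t, jumpKernel x t * f t =
      (Set.Iic x).indicator f t - (if 0 < x then f t else 0) := by
    intro t
    unfold jumpKernel
    rw [sub_mul, Set.indicator_apply]
    simp only [Set.mem_Iic]
    split_ifs <;> simp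
  unfold jumpPrim
  simp_rw [h1]
  rw [integral_sub (hf.indicator measurableSet_Iic), integral_indicator measurableSet_Iic]
  · split_ifs <;> simp
  · split_ifs
    · exact hf
    · exact integrable_zero _ _ _

theorem integrable_prod_jumpKernel_of_bounded {f M : ℝ → ℂ} (hf : Integrable f)
    (htf : Integrable fun t : ℝ => ((|t| : ℝ) : ℂ) * f t)
    (hM : AEStronglyMeasurable M volume) {C : ℝ} (hC : ∀ x, ‖M x‖ ≤ C) :
    Integrable (fun p : ℝ × ℝ => jumpKernel p.1 p.2 * (M p.1 * f p.2)) (volume.prod volume) := by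
  have hm : AEStronglyMeasurable
      (fun p : ℝ × ℝ => jumpKernel p.1 p.2 * (M p.1 * f p.2)) (volume.prod volume) :=
    measurable_jumpKernel.aestronglyMeasurable.mul (hM.comp_fst.mul hf.1.comp_snd)
  have hset : MeasurableSet {p : ℝ × ℝ | p.1 ∈ Set.Icc (-|p.2|) |p.2|} := by
    have h1 : MeasurableSet {p : ℝ × ℝ | -|p.2| ≤ p.1} :=
      measurableSet_le (by fun_prop) (by fun_prop)
    have h2 : MeasurableSet {p : ℝ × ℝ | p.1 ≤ |p.2|} :=
      measurableSet_le (by fun_prop) (by fun_prop)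
    exact h1.inter h2
  have hdom : Integrable (fun p : ℝ × ℝ =>
      (Set.Icc (-|p.2|) |p.2|).indicator (fun _ => (1 : ℝ)) p.1 * (C * ‖f p.2‖))
      (volume.prod volume) := by
    have hm' : AEStronglyMeasurable (fun p : ℝ × ℝ =>
        (Set.Icc (-|p.2|) |p.2|).indicator (fun _ => (1 : ℝ)) p.1 * (C * ‖f p.2‖))
        (volume.prod volume) := by
      refine AEStronglyMeasurable.mul ?_ (hf.1.comp_snd.norm.const_mul C)
      have : (fun p : ℝ × ℝ => (Set.Icc (-|p.2|) |p.2|).indicator (fun _ => (1 : ℝ)) p.1) =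
          Set.indicator {p : ℝ × ℝ | p.1 ∈ Set.Icc (-|p.2|) |p.2|} (fun _ => (1 : ℝ)) := by
        ext p; simp only [Set.indicator_apply, Set.mem_ofPred_eq]
      rw [this]
      exact (measurable_const.indicator hset).aestronglyMeasurable
    rw [integrable_prod_iff' hm']
    have hC0 : 0 ≤ C := (norm_nonneg _).trans (hC 0)
    constructor
    · refine ae_of_all _ fun t => ?_
      refine Integrable.mul_const (f := (Set.Icc (-|t|) |t|).indicator fun _ => (1 : ℝ)) ?_
        (C * ‖f t‖)
      exact (integrable_indicator_iff measurableSet_Icc).2 (by simp)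
    · refine (htf.norm.const_mul (2 * C)).congr (ae_of_all _ fun t => ?_)
      have : ∀ x : ℝ, ‖(Set.Icc (-|t|) |t|).indicator (fun _ => (1 : ℝ)) x * (C * ‖f t‖)‖ =
          (Set.Icc (-|t|) |t|).indicator (fun _ => (1 : ℝ)) x * (C * ‖f t‖) := by
        intro x
        rw [Real.norm_of_nonneg]
        exact mul_nonneg (Set.indicator_nonneg (fun _ _ => zero_le_one) _) (by positivity)
      simp only [this]
      rw [integral_mul_const, integral_indicator measurableSet_Icc]
      simp
      ring
  refine hdom.mono' hm (ae_of_all _ fun p => ?_)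
  rw [norm_mul, norm_mul]
  refine mul_le_mul (norm_jumpKernel_le_indicator _ _) ?_ (by positivity)
    (Set.indicator_nonneg (fun _ _ => zero_le_one) _)
  gcongr
  exact hC _

theorem integrable_prod_jumpKernel_of_integrable {f M : ℝ → ℂ} (hf : Integrable f)
    (hM : Integrable M) :
    Integrable (fun p : ℝ × ℝ => jumpKernel p.1 p.2 * (M p.1 * f p.2)) (volume.prod volume) :=
  (hM.mul_prod hf).bdd_mul measurable_jumpKernel.aestronglyMeasurable
    (c := 1) (ae_of_all _ fun _ => norm_jumpKernel_le _ _)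

theorem integral_jumpKernel_mul (M : ℝ → ℂ) (t : ℝ) :
    ∫ x, jumpKernel x t * M x = -∫ x in (0 : ℝ)..t, M x := by
  rcases le_or_gt t 0 with ht | ht
  · rw [intervalIntegral.integral_symm, neg_neg, intervalIntegral.integral_of_le ht,
      ← integral_Icc_eq_integral_Ioc, ← integral_indicator measurableSet_Icc]
    congr 1; ext x
    rcases le_or_gt x 0 with hx | hx
    · rw [jumpKernel_of_nonpos hx, Set.indicator_apply]
      simp [Set.mem_Icc, hx]
    · rw [jumpKernel_of_pos hx, Set.indicator_of_notMem (by simp [hx]), if_neg (by linarith)]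
      simp
  · rw [intervalIntegral.integral_of_le ht.le, integral_Ioc_eq_integral_Ioo,
      ← integral_indicator measurableSet_Ioo, ← integral_neg]
    congr 1; ext x
    rcases le_or_gt x 0 with hx | hx
    · rw [jumpKernel_of_nonpos hx, Set.indicator_of_notMem (by simp [hx]), if_neg (by linarith)]
      simp
    · rw [jumpKernel_of_pos hx, Set.indicator_apply]
      by_cases h : x < t <;> simp [Set.mem_Ioo, hx, h]

theorem integrable_mul_jumpPrim {f M : ℝ → ℂ}
    (h : Integrable (fun p : ℝ × ℝ => jumpKernel p.1 p.2 * (M p.1 * f p.2))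
      (volume.prod volume)) : Integrable (fun x => M x * jumpPrim f x) := by
  refine h.integral_prod_left.congr (ae_of_all _ fun x => ?_)
  simp only [jumpPrim]
  rw [← integral_const_mul]
  congr 1; ext t; ring

/-- Integration by parts via Fubini. Starting the primitive of `M` at `0` makes it vanish where
`jumpPrim f` jumps, so no boundary term appears. -/
theorem integral_mul_jumpPrim {f M : ℝ → ℂ}
    (h : Integrable (fun p : ℝ × ℝ => jumpKernel p.1 p.2 * (M p.1 * f p.2))
      (volume.prod volume)) :
    ∫ x, M x * jumpPrim f x = -∫ t, (∫ x in (0 : ℝ)..t, M x) * f t := by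
  have h1 : ∀ x, M x * jumpPrim f x = ∫ t, jumpKernel x t * (M x * f t) := by
    intro x
    unfold jumpPrim
    rw [← integral_const_mul]
    congr 1; ext t; ring
  simp_rw [h1]
  rw [integral_integral_swap h, ← integral_neg]
  congr 1; ext t
  rw [← neg_mul, ← integral_jumpKernel_mul, ← integral_mul_const]
  congr 1; ext x; ring

/-- The product rule for the primitive. -/
theorem mul_jumpPrim {f M M' : ℝ → ℂ} (hFTC : ∀ a b, ∫ y in a..b, M' y = M b - M a)
    (hint : Integrable (fun p : ℝ × ℝ => jumpKernel p.1 p.2 * (M' p.1 * f p.2))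
      (volume.prod volume)) (hf : Integrable f) (hMf : Integrable fun t => M t * f t) (x : ℝ) :
    M x * jumpPrim f x = jumpPrim (fun y => M' y * jumpPrim f y + M y * f y) x := by
  rw [jumpPrim_add (integrable_mul_jumpPrim hint) hMf]
  have hint2 : Integrable (fun p : ℝ × ℝ =>
      jumpKernel x p.1 * (jumpKernel p.1 p.2 * (M' p.1 * f p.2))) (volume.prod volume) :=
    hint.bdd_mul ((measurable_jumpKernel.comp
      (measurable_const.prodMk measurable_fst)).aestronglyMeasurable)
      (c := 1) (ae_of_all _ fun _ => norm_jumpKernel_le _ _)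
  have h1 : jumpPrim (fun y => M' y * jumpPrim f y) x =
      ∫ t, -(jumpKernel x t * ((M t - M x) * f t)) := by
    have e : ∀ y, jumpKernel x y * (M' y * jumpPrim f y) =
        ∫ t, jumpKernel x y * (jumpKernel y t * (M' y * f t)) := by
      intro y
      unfold jumpPrim
      rw [← integral_const_mul, ← integral_const_mul]
      congr 1; ext t; ring
    rw [jumpPrim]
    simp_rw [e]
    rw [integral_integral_swap hint2]
    congr 1; ext t
    -- The product of kernels is nonzero only for `y` between `t` and `x`, on one side of the
    -- origin, so the fundamental theorem of calculus never crosses the jump.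
    have e2 : ∫ y, jumpKernel x y * jumpKernel y t * M' y = -(jumpKernel x t * (M t - M x)) := by
      rcases le_or_gt x 0 with hx | hx
      · rw [jumpKernel_of_nonpos hx]
        rcases le_or_gt t x with htx | htx
        · rw [if_pos htx, one_mul, ← hFTC, ← intervalIntegral.integral_symm,
            intervalIntegral.integral_of_le htx, ← integral_Icc_eq_integral_Ioc,
            ← integral_indicator measurableSet_Icc]
          congr 1; ext y
          rw [jumpKernel_of_nonpos hx, Set.indicator_apply]
          by_cases hy : y ≤ x
          · rw [jumpKernel_of_nonpos (hy.trans hx)]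
            simp [Set.mem_Icc, hy]
          · simp [hy]
        · rw [if_neg htx.not_ge, zero_mul, neg_zero]
          rw [← integral_zero ℝ ℂ]
          congr 1; ext y
          rw [jumpKernel_of_nonpos hx]
          by_cases hy : y ≤ x
          · rw [jumpKernel_of_nonpos (hy.trans hx), if_neg (by linarith : ¬ t ≤ y)]; simp
          · simp [hy]
      · rw [jumpKernel_of_pos hx]
        rcases lt_or_ge x t with htx | htx
        · rw [if_pos htx, neg_one_mul, neg_neg, ← hFTC,
            intervalIntegral.integral_of_le htx.le, integral_Ioc_eq_integral_Ioo,
            ← integral_indicator measurableSet_Ioo]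
          congr 1; ext y
          rw [jumpKernel_of_pos hx, Set.indicator_apply]
          by_cases hy : x < y
          · rw [jumpKernel_of_pos (hx.trans hy)]
            by_cases hy2 : y < t <;> simp [hy, hy2]
          · simp [hy]
        · rw [if_neg htx.not_gt, zero_mul, neg_zero]
          rw [← integral_zero ℝ ℂ]
          congr 1; ext y
          rw [jumpKernel_of_pos hx]
          by_cases hy : x < y
          · rw [jumpKernel_of_pos (hx.trans hy), if_neg (by linarith : ¬ y < t)]; simp
          · simp [hy]
    calc _ = ∫ y, (jumpKernel x y * jumpKernel y t * M' y) * f t := by congr 1; ext y; ring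
      _ = _ := by rw [integral_mul_const, e2]; ring
  have i1 : Integrable fun t => -(jumpKernel x t * ((M t - M x) * f t)) := by
    refine (integrable_jumpKernel_mul (hMf.sub (hf.const_mul (M x))) x).neg.congr
      (ae_of_all _ fun t => ?_)
    simp only [Pi.neg_apply, Pi.sub_apply]; ring
  rw [h1, jumpPrim, jumpPrim, ← integral_const_mul,
    ← integral_add i1 (integrable_jumpKernel_mul hMf x)]
  congr 1; ext t; ring

/-- The kernel couples only points on the same side of the origin, where the sign is constant. -/
theorem sign_mul_jumpPrim (f : ℝ → ℂ) :
    (fun x : ℝ => (Real.sign x : ℂ) * jumpPrim f x) =ᵐ[volume]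
      jumpPrim (fun t : ℝ => (Real.sign t : ℂ) * f t) := by
  have : ∀ᵐ x : ℝ, x ≠ 0 := by simp [ae_iff]
  filter_upwards [this] with x hx
  unfold jumpPrim
  rw [← integral_const_mul]
  congr 1; ext t
  rcases lt_or_gt_of_ne hx with hx | hx
  · rw [jumpKernel_of_nonpos hx.le]
    split_ifs with h
    · simp only [Real.sign_of_neg hx, Real.sign_of_neg (h.trans_lt hx)]; ring
    · simp
  · rw [jumpKernel_of_pos hx]
    split_ifs with h
    · simp only [Real.sign_of_pos hx, Real.sign_of_pos (hx.trans h)]; ring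
    · simp

/-- The jump of `jumpPrim f` at `0` is `-∫ f`, so its distributional derivative is `f - (∫ f) δ`;
convolving with `l` gives the integrand on the right. -/
theorem conv_jumpPrim {f l : ℝ → ℂ} (hf : Integrable f) (hl : Integrable l) :
    conv (jumpPrim f) l = jumpPrim (fun t => conv f l t + (-∫ s, f s) * l t) := by
  have hfl := integrable_conv hf hl
  -- Zero mean means that the primitive from `-∞` already vanishes at `+∞`: the convolution itself
  -- has no jump.
  have htot : ∫ t, (conv f l t + (-∫ s, f s) * l t) = 0 := by
    rw [integral_add hfl (hl.const_mul _), integral_const_mul]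
    have : ∫ t, conv f l t = (∫ s, f s) * ∫ s, l s := integral_convolution _ hf hl
    rw [this]; ring
  ext x
  rw [jumpPrim_eq (f := fun t => conv f l t + (-∫ s, f s) * l t) (hfl.add (hl.const_mul _)),
    htot, ite_self, sub_zero]
  have h3 : ∫ t in Set.Iic x, (conv f l t + (-∫ s, f s) * l t) =
      (∫ t in Set.Iic x, conv f l t) + (-∫ s, f s) * ∫ t in Set.Iic x, l t := by
    rw [integral_add hfl.integrableOn ((hl.const_mul _).integrableOn), integral_const_mul]
  rw [h3]
  have hlx : Integrable fun z => l (x - z) := hl.comp_sub_left x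
  have h1 : conv (jumpPrim f) l x =
      ∫ y, f y * ((∫ w in Set.Iic (x - y), l w) - ∫ w in Set.Iic x, l w) := by
    have hi : Integrable (fun p : ℝ × ℝ => jumpKernel p.1 p.2 * (l (x - p.1) * f p.2))
        (volume.prod volume) :=
      integrable_prod_jumpKernel_of_integrable (M := fun z => l (x - z)) hf hlx
    rw [conv_apply]
    have e : ∀ z, jumpPrim f z * l (x - z) = ∫ y, jumpKernel z y * (l (x - z) * f y) := by
      intro z
      unfold jumpPrim
      rw [← integral_mul_const]
      congr 1; ext y; ring
    simp_rw [e]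
    rw [integral_integral_swap hi]
    congr 1; ext y
    have key : ∀ a : ℝ, ∫ z, (Set.Ici a).indicator (fun z => l (x - z)) z =
        ∫ w in Set.Iic (x - a), l w := by
      intro a
      rw [← integral_indicator measurableSet_Iic,
        ← integral_sub_left_eq_self ((Set.Iic (x - a)).indicator l) volume x]
      congr 1; ext z
      have : x - z ≤ x - a ↔ a ≤ z := sub_le_sub_iff_left x
      simp only [Set.indicator_apply, Set.mem_Iic, Set.mem_Ici, this]
    have e2 : ∫ z, jumpKernel z y * l (x - z) =
        (∫ w in Set.Iic (x - y), l w) - ∫ w in Set.Iic x, l w := by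
      have h0 := key 0
      rw [sub_zero] at h0
      rw [← key, ← h0, ← integral_sub (hlx.indicator measurableSet_Ici)
        (hlx.indicator measurableSet_Ici)]
      apply integral_congr_ae
      have : ∀ᵐ z : ℝ, z ≠ 0 := by simp [ae_iff]
      filter_upwards [this] with z hz
      simp only [jumpKernel, Set.indicator_apply, Set.mem_Ici]
      have : 0 ≤ z ↔ 0 < z := ⟨fun h => lt_of_le_of_ne h hz.symm, le_of_lt⟩
      simp only [this]
      split_ifs <;> simp
    rw [← e2, ← integral_const_mul]
    congr 1; ext z; ring
  have h2 : ∫ w in Set.Iic x, conv f l w = ∫ y, f y * ∫ w in Set.Iic (x - y), l w := by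
    have hi : Integrable (fun p : ℝ × ℝ => f p.2 * l (p.1 - p.2))
        ((volume.restrict (Set.Iic x)).prod volume) := by
      have := hf.convolution_integrand (ContinuousLinearMap.mul ℂ ℂ) hl
      refine this.mono_measure ?_
      exact Measure.prod_mono Measure.restrict_le_self le_rfl
    simp_rw [conv_apply]
    rw [integral_integral_swap hi]
    congr 1; ext y
    rw [integral_const_mul]
    congr 1
    rw [← integral_indicator measurableSet_Iic, ← integral_indicator measurableSet_Iic,
      ← integral_sub_right_eq_self ((Set.Iic (x - y)).indicator l) y]
    congr 1; ext z
    simp [Set.indicator_apply]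
  have hb : ∀ a : ℝ, ‖∫ w in Set.Iic a, l w‖ ≤ ∫ w, ‖l w‖ := fun a =>
    (norm_integral_le_integral_norm _).trans
      (setIntegral_le_integral hl.norm (ae_of_all _ fun _ => norm_nonneg _))
  rw [h1, h2]
  have i2 : Integrable fun y => f y * ∫ w in Set.Iic x, l w := hf.mul_const _
  have i1 : Integrable fun y => f y * ∫ w in Set.Iic (x - y), l w := by
    have hcont : Continuous fun a : ℝ => ∫ w in Set.Iic a, l w := by
      have : (fun a : ℝ => ∫ w in Set.Iic a, l w) =
          fun a => (∫ w in Set.Iic (0 : ℝ), l w) + ∫ w in (0 : ℝ)..a, l w := by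
        ext a
        rw [← intervalIntegral.integral_Iic_sub_Iic hl.integrableOn hl.integrableOn]
        ring
      rw [this]
      exact continuous_const.add (intervalIntegral.continuous_primitive
        (fun a b => hl.intervalIntegrable) 0)
    exact hf.mul_bdd (c := ∫ w, ‖l w‖)
      (hcont.comp (continuous_const.sub continuous_id)).aestronglyMeasurable
      (ae_of_all _ fun y => hb _)
  simp_rw [mul_sub]
  rw [integral_sub i1 i2, integral_mul_const]
  ring

end Primitive

/-! ### Calculus of functions smooth away from the origin -/

section JumpSmooth

/-- `k` lies in the weighted space `WeightedL2 s` together with its first `n` derivatives on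
`ℝ \ {0}`; jumps at the origin are allowed. -/
def JumpSmooth (s : ℕ) : ℕ → (ℝ → ℂ) → Prop
  | 0, k => WeightedL2 s k
  | n + 1, k => WeightedL2 s k ∧ ∃ k₁, JumpSmooth s n k₁ ∧ k =ᵐ[volume] jumpPrim k₁

theorem measurable_ofReal_sign : Measurable fun x : ℝ => ((Real.sign x : ℝ) : ℂ) := by
  refine Complex.measurable_ofReal.comp ?_
  unfold Real.sign
  exact Measurable.ite measurableSet_Iio measurable_const
    (Measurable.ite measurableSet_Ioi measurable_const measurable_const)

theorem norm_ofReal_sign_le (x : ℝ) : ‖((Real.sign x : ℝ) : ℂ)‖ ≤ 1 := by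
  rcases Real.sign_apply_eq x with h | h | h <;> simp [h]

theorem hasDerivAt_abs_sign {x : ℝ} (hx : x ≠ 0) :
    HasDerivAt (fun y : ℝ => |y|) (Real.sign x) x := by
  rcases lt_or_gt_of_ne hx with h | h
  · rw [Real.sign_of_neg h]; exact hasDerivAt_abs_neg h
  · rw [Real.sign_of_pos h]; exact hasDerivAt_abs_pos h

theorem intervalIntegrable_of_bounded {M : ℝ → ℂ} (hM : Measurable M) {C : ℝ}
    (hC : ∀ x, ‖M x‖ ≤ C) (a b : ℝ) : IntervalIntegrable M volume a b :=
  (intervalIntegrable_const (c := C)).mono_fun hM.aestronglyMeasurable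
    (ae_of_all _ fun x => (hC x).trans (Real.le_norm_self C))

theorem integral_sign_eq (a b : ℝ) :
    ∫ y in a..b, ((Real.sign y : ℝ) : ℂ) = ((|b| : ℝ) : ℂ) - ((|a| : ℝ) : ℂ) := by
  refine integral_eq_of_hasDerivAt_off_countable (fun y : ℝ => ((|y| : ℝ) : ℂ)) _
    (Set.countable_singleton 0) (by fun_prop) (fun x hx => ?_)
    (intervalIntegrable_of_bounded measurable_ofReal_sign norm_ofReal_sign_le a b)
  exact (hasDerivAt_abs_sign (by simpa using hx.2)).ofReal_comp

namespace JumpSmooth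

variable {s n : ℕ} {k l : ℝ → ℂ}

theorem weightedL2 (h : JumpSmooth s n k) : WeightedL2 s k := by
  cases n with
  | zero => exact h
  | succ n => exact h.1

theorem congr (h : JumpSmooth s n k) (hkl : k =ᵐ[volume] l) : JumpSmooth s n l := by
  cases n with
  | zero => exact WeightedL2.congr h hkl
  | succ n =>
    obtain ⟨h0, k₁, h1, h2⟩ := h
    exact ⟨h0.congr hkl, k₁, h1, hkl.symm.trans h2⟩

theorem pred (h : JumpSmooth s (n + 1) k) : JumpSmooth s n k := by
  induction n generalizing k with
  | zero => exact h.1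
  | succ n ih =>
    obtain ⟨h0, k₁, h1, h2⟩ := h
    exact ⟨h0, k₁, ih h1, h2⟩

theorem mono_weight (h : JumpSmooth s n k) {t : ℕ} (ht : t ≤ s) : JumpSmooth t n k := by
  induction n generalizing k with
  | zero => exact WeightedL2.mono h ht
  | succ n ih =>
    obtain ⟨h0, k₁, h1, h2⟩ := h
    exact ⟨h0.mono ht, k₁, ih h1, h2⟩

theorem add (hs : 1 ≤ s) (hk : JumpSmooth s n k) (hl : JumpSmooth s n l) :
    JumpSmooth s n (fun ξ => k ξ + l ξ) := by
  induction n generalizing k l with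
  | zero => exact WeightedL2.add hk hl
  | succ n ih =>
    obtain ⟨h0, k₁, h1, h2⟩ := hk
    obtain ⟨h0', l₁, h1', h2'⟩ := hl
    refine ⟨h0.add h0', _, ih h1 h1', ?_⟩
    filter_upwards [h2, h2'] with x hx hx'
    rw [jumpPrim_add (h1.weightedL2.integrable_of_le hs) (h1'.weightedL2.integrable_of_le hs),
      hx, hx']

theorem const_mul (hk : JumpSmooth s n k) (c : ℂ) : JumpSmooth s n (fun ξ => c * k ξ) := by
  induction n generalizing k with
  | zero => exact WeightedL2.const_mul hk c
  | succ n ih =>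
    obtain ⟨h0, k₁, h1, h2⟩ := hk
    refine ⟨h0.const_mul c, _, ih h1, ?_⟩
    filter_upwards [h2] with x hx
    rw [jumpPrim_const_mul, hx]

theorem sign_mul (hk : JumpSmooth s n k) :
    JumpSmooth s n (fun ξ => ((Real.sign ξ : ℝ) : ℂ) * k ξ) := by
  have hw : ∀ {k}, WeightedL2 s k → WeightedL2 s (fun ξ => ((Real.sign ξ : ℝ) : ℂ) * k ξ) :=
    fun hk => hk.mul_left measurable_ofReal_sign.aestronglyMeasurable 1 fun ξ => by
      rw [mul_comm]
      exact mul_le_mul_of_nonneg_right (norm_ofReal_sign_le ξ) (by positivity)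
  induction n generalizing k with
  | zero => exact hw hk
  | succ n ih =>
    obtain ⟨h0, k₁, h1, h2⟩ := hk
    refine ⟨hw h0, _, ih h1, ?_⟩
    refine Filter.EventuallyEq.trans ?_ (sign_mul_jumpPrim k₁)
    filter_upwards [h2] with x hx
    rw [hx]

theorem _root_.WeightedL2.abs_mul (hk : WeightedL2 (s + 1) k) :
    WeightedL2 s (fun ξ => ((|ξ| : ℝ) : ℂ) * k ξ) :=
  hk.mul_left (by fun_prop) 1 fun ξ => by
    rw [Complex.norm_real, Real.norm_of_nonneg (abs_nonneg ξ), one_mul, pow_succ]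
    gcongr
    linarith

/-- Product rule with derivative `sign ξ · k + |ξ| k₁`. The new discontinuity sits at the origin,
where jumps are allowed; only one power of the weight is lost. -/
theorem abs_mul (hk : JumpSmooth 2 n k) :
    JumpSmooth 1 n (fun ξ => ((|ξ| : ℝ) : ℂ) * k ξ) := by
  induction n generalizing k with
  | zero => exact WeightedL2.abs_mul hk
  | succ n ih =>
    have hk' := hk
    obtain ⟨h0, k₁, h1, h2⟩ := hk
    have i1 := h1.weightedL2.integrable_of_le one_le_two
    have i2 := h1.weightedL2.abs_mul.integrable
    refine ⟨h0.abs_mul, fun ξ => ((Real.sign ξ : ℝ) : ℂ) * k ξ + ((|ξ| : ℝ) : ℂ) * k₁ ξ,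
      (hk'.pred.sign_mul.mono_weight one_le_two).add le_rfl (ih h1), ?_⟩
    have e : jumpPrim (fun ξ : ℝ => ((Real.sign ξ : ℝ) : ℂ) * k ξ + ((|ξ| : ℝ) : ℂ) * k₁ ξ) =
        jumpPrim (fun ξ : ℝ => ((Real.sign ξ : ℝ) : ℂ) * jumpPrim k₁ ξ +
          ((|ξ| : ℝ) : ℂ) * k₁ ξ) := by
      apply jumpPrim_congr
      filter_upwards [h2] with x hx
      rw [hx]
    rw [e]
    filter_upwards [h2] with x hx
    rw [hx]
    exact mul_jumpPrim (M := fun x : ℝ => ((|x| : ℝ) : ℂ)) integral_sign_eq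
      (integrable_prod_jumpKernel_of_bounded (M := fun x : ℝ => ((Real.sign x : ℝ) : ℂ)) i1 i2
        measurable_ofReal_sign.aestronglyMeasurable
        norm_ofReal_sign_le) i1 i2 x

end JumpSmooth

/-- The symbol of `(A + B |D|)⁻¹`. -/
noncomputable def resolventSymbol (A B ξ : ℝ) : ℂ := (((A + B * |ξ|)⁻¹ : ℝ) : ℂ)

/-! ### Multiplication by the symbol of the resolvent -/

section Resolvent

variable {A B : ℝ}

theorem continuous_resolventSymbol (hA : 0 < A) (hB : 0 < B) :
    Continuous (resolventSymbol A B) := by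
  unfold resolventSymbol
  refine Complex.continuous_ofReal.comp (Continuous.inv₀ (by fun_prop) fun ξ => ?_)
  positivity

theorem norm_resolventSymbol_mul_le (hA : 0 < A) (hB : 0 < B) (ξ : ℝ) :
    (1 + |ξ|) * ‖resolventSymbol A B ξ‖ ≤ A⁻¹ + B⁻¹ := by
  have h : 0 < A + B * |ξ| := by positivity
  rw [resolventSymbol, Complex.norm_real, Real.norm_of_nonneg (by positivity),
    ← div_eq_mul_inv, div_le_iff₀ h]
  have e : (A⁻¹ + B⁻¹) * (A + B * |ξ|) = 1 + |ξ| + (A⁻¹ * (B * |ξ|) + B⁻¹ * A) := by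
    field_simp
    ring
  rw [e]
  have : 0 ≤ A⁻¹ * (B * |ξ|) + B⁻¹ * A := by positivity
  linarith

theorem WeightedL2.resolventSymbol_mul (hA : 0 < A) (hB : 0 < B) {s : ℕ} {k : ℝ → ℂ}
    (hk : WeightedL2 s k) :
    WeightedL2 (s + 1) (fun ξ => resolventSymbol A B ξ * k ξ) :=
  hk.mul_left (continuous_resolventSymbol hA hB).aestronglyMeasurable (A⁻¹ + B⁻¹) fun ξ => by
    rw [pow_succ, mul_assoc, mul_comm]
    exact mul_le_mul_of_nonneg_right (norm_resolventSymbol_mul_le hA hB ξ) (by positivity)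

theorem norm_deriv_resolventSymbol_le (hA : 0 < A) (hB : 0 < B) (ξ : ℝ) :
    ‖-B * ((Real.sign ξ : ℝ) : ℂ) * resolventSymbol A B ξ ^ 2‖ ≤
      B * (A⁻¹ + B⁻¹) ^ 2 * (1 + ξ ^ 2)⁻¹ := by
  have h1 : ‖resolventSymbol A B ξ‖ ≤ (A⁻¹ + B⁻¹) * (1 + |ξ|)⁻¹ := by
    rw [← div_eq_mul_inv, le_div_iff₀ (by positivity), mul_comm]
    exact norm_resolventSymbol_mul_le hA hB ξ
  rw [norm_mul, norm_mul, norm_neg, norm_pow, Complex.norm_real, Real.norm_of_nonneg hB.le]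
  calc _ ≤ B * 1 * ((A⁻¹ + B⁻¹) * (1 + |ξ|)⁻¹) ^ 2 := by
        gcongr
        exact norm_ofReal_sign_le ξ
    _ = B * (A⁻¹ + B⁻¹) ^ 2 * ((1 + |ξ|) ^ 2)⁻¹ := by rw [mul_pow, inv_pow]; ring
    _ ≤ _ := by
        gcongr
        nlinarith [abs_nonneg ξ, sq_abs ξ]

theorem measurable_deriv_resolventSymbol (hA : 0 < A) (hB : 0 < B) :
    Measurable fun ξ : ℝ => -(B : ℂ) * ((Real.sign ξ : ℝ) : ℂ) * resolventSymbol A B ξ ^ 2 :=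
  (measurable_ofReal_sign.const_mul _).mul
    ((continuous_resolventSymbol hA hB).measurable.pow_const 2)

theorem integral_deriv_resolventSymbol (hA : 0 < A) (hB : 0 < B) (a b : ℝ) :
    ∫ y in a..b, -(B : ℂ) * ((Real.sign y : ℝ) : ℂ) * resolventSymbol A B y ^ 2 =
      resolventSymbol A B b - resolventSymbol A B a := by
  refine integral_eq_of_hasDerivAt_off_countable (resolventSymbol A B) _
    (Set.countable_singleton 0) (continuous_resolventSymbol hA hB).continuousOn (fun x hx => ?_)
    (intervalIntegrable_of_bounded (measurable_deriv_resolventSymbol hA hB)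
      (C := B * (A⁻¹ + B⁻¹) ^ 2) (fun ξ => ?_) a b)
  · have h : A + B * |x| ≠ 0 := by positivity
    have h1 := ((((hasDerivAt_abs_sign (by simpa using hx.2 : x ≠ 0)).const_mul B).const_add
      A).fun_inv h).ofReal_comp
    have e : -(B : ℂ) * ((Real.sign x : ℝ) : ℂ) * resolventSymbol A B x ^ 2 =
        ((-(B * Real.sign x) / (A + B * |x|) ^ 2 : ℝ) : ℂ) := by
      rw [div_eq_mul_inv, ← inv_pow]
      simp only [resolventSymbol]
      push_cast
      ring
    rw [e]
    exact h1
  · refine (norm_deriv_resolventSymbol_le hA hB ξ).trans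
      (mul_le_of_le_one_right (by positivity) (inv_le_one_of_one_le₀ ?_))
    nlinarith [sq_nonneg ξ]

theorem JumpSmooth.resolventSymbol_mul (hA : 0 < A) (hB : 0 < B) {n : ℕ} {k : ℝ → ℂ}
    (hk : JumpSmooth 1 n k) :
    JumpSmooth 2 n (fun ξ => resolventSymbol A B ξ * k ξ) := by
  induction n generalizing k with
  | zero => exact WeightedL2.resolventSymbol_mul hA hB hk
  | succ n ih =>
    have hk' := hk
    obtain ⟨h0, k₁, h1, h2⟩ := hk
    have i1 := h1.weightedL2.integrable
    have hd : Integrable fun ξ : ℝ =>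
        -(B : ℂ) * ((Real.sign ξ : ℝ) : ℂ) * resolventSymbol A B ξ ^ 2 :=
      (integrable_inv_one_add_sq.const_mul (B * (A⁻¹ + B⁻¹) ^ 2)).mono'
        (measurable_deriv_resolventSymbol hA hB).aestronglyMeasurable
        (ae_of_all _ (norm_deriv_resolventSymbol_le hA hB))
    -- The symbol `m` satisfies `m' = -B sign(ξ) m²`, so the term `m' k` is handled by applying the
    -- induction hypothesis twice.
    have hr := ih hk'.pred
    have hrr := (ih (hr.mono_weight one_le_two)).sign_mul.const_mul (-(B : ℂ))
    refine ⟨WeightedL2.resolventSymbol_mul hA hB h0, _, hrr.add one_le_two (ih h1), ?_⟩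
    have e : jumpPrim (fun ξ : ℝ => -(B : ℂ) * (((Real.sign ξ : ℝ) : ℂ) *
          (resolventSymbol A B ξ * (resolventSymbol A B ξ * k ξ))) +
          resolventSymbol A B ξ * k₁ ξ) =
        jumpPrim (fun ξ : ℝ => -(B : ℂ) * ((Real.sign ξ : ℝ) : ℂ) * resolventSymbol A B ξ ^ 2 *
          jumpPrim k₁ ξ + resolventSymbol A B ξ * k₁ ξ) := by
      apply jumpPrim_congr
      filter_upwards [h2] with x hx
      rw [hx]; ring
    rw [e]
    filter_upwards [h2] with x hx
    rw [hx]
    exact mul_jumpPrim (integral_deriv_resolventSymbol hA hB)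
      (integrable_prod_jumpKernel_of_integrable (M := fun ξ : ℝ =>
        -(B : ℂ) * ((Real.sign ξ : ℝ) : ℂ) * resolventSymbol A B ξ ^ 2) i1 hd) i1
      (WeightedL2.resolventSymbol_mul hA hB (h1.weightedL2.mono zero_le_one)).integrable x

end Resolvent

theorem conv_congr {k k' l l' : ℝ → ℂ} (hk : k =ᵐ[volume] k') (hl : l =ᵐ[volume] l') :
    conv k l = conv k' l' := by
  have h1 : ∀ {k k' l : ℝ → ℂ}, k =ᵐ[volume] k' → conv k l = conv k' l := by
    intro k k' l h
    ext x
    rw [conv_apply, conv_apply]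
    apply integral_congr_ae
    filter_upwards [h] with t ht
    rw [ht]
  rw [h1 hk, conv_comm k', h1 hl, conv_comm]

namespace JumpSmooth

variable {s n : ℕ} {k l : ℝ → ℂ}

/-- By `conv_jumpPrim` the derivative of `k * l` is `k₁ * l - (∫ k₁) l`, so `p` derivatives of both
terms give `p + 1` of the convolution. -/
theorem conv_succ_of_conv (hs : 1 ≤ s) {p : ℕ} (hk : JumpSmooth s (n + 1) k)
    (hl : JumpSmooth s p l)
    (h : ∀ {k₁}, JumpSmooth s n k₁ → JumpSmooth s p (_root_.conv k₁ l)) :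
    JumpSmooth s (p + 1) (_root_.conv k l) := by
  obtain ⟨h0, k₁, h1, h2⟩ := hk
  have i1 := h1.weightedL2.integrable_of_le hs
  have il := hl.weightedL2.integrable_of_le hs
  refine ⟨h0.conv hs hl.weightedL2, _, (h h1).add hs (hl.const_mul (-∫ x, k₁ x)), ?_⟩
  rw [← conv_jumpPrim i1 il, conv_congr h2 (ae_eq_refl l)]

theorem conv_self (hs : 1 ≤ s) (hk : JumpSmooth s n k) (hl : JumpSmooth s n l) :
    JumpSmooth s n (_root_.conv k l) := by
  induction n generalizing k l with
  | zero => exact WeightedL2.conv hs hk hl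
  | succ n ih => exact hk.conv_succ_of_conv hs hl.pred fun h1 => ih h1 hl.pred

/-- Convolution gains one derivative. -/
theorem conv_gain (hs : 1 ≤ s) (hk : JumpSmooth s (n + 1) k) (hl : JumpSmooth s (n + 1) l) :
    JumpSmooth s (n + 2) (_root_.conv k l) := by
  -- Differentiate `k` once and then, after commuting, `l` once; the remaining `k₁ * l₁` has `n`
  -- derivatives, two below the target.
  refine hk.conv_succ_of_conv hs hl fun {k₁} h1 => ?_
  rw [conv_comm]
  exact hl.conv_succ_of_conv hs h1 fun h2 => h2.conv_self hs h1

/-- `2πiα 𝓕⁻k(α) = 𝓕⁻k'(0) - 𝓕⁻k'(α)`. -/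
theorem fourierInv_jumpPrim {f : ℝ → ℂ} (hf : WeightedL2 2 f) (hk : k =ᵐ[volume] jumpPrim f)
    (α : ℝ) : 2 * Real.pi * Complex.I * α * 𝓕⁻ k α = 𝓕⁻ f 0 - 𝓕⁻ f α := by
  have i1 := hf.integrable_of_le one_le_two
  have i2 := hf.abs_mul.integrable
  set e : ℝ → ℂ := fun x => Complex.exp (2 * Real.pi * Complex.I * α * x) with he
  have hint : ∀ g : ℝ → ℂ, 𝓕⁻ g α = ∫ x, e x * g x := by
    intro g
    rw [Real.fourierInv_eq']
    congr 1; ext x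
    simp only [smul_eq_mul, he]
    congr 2
    simp
    ring
  have h0 : 𝓕⁻ f 0 = ∫ x, f x := by
    rw [Real.fourierInv_eq']; simp
  have hne : ∀ x, ‖e x‖ ≤ 1 := by
    intro x
    have : (2 * Real.pi * Complex.I * α * x : ℂ) = ((2 * Real.pi * α * x : ℝ) : ℂ) * Complex.I := by
      push_cast; ring
    simp only [he]
    rw [this, Complex.norm_exp_ofReal_mul_I]
  have hec : Continuous e := by fun_prop
  have hprod := integrable_prod_jumpKernel_of_bounded i1 i2 hec.aestronglyMeasurable hne
  have h1 : 𝓕⁻ k α = ∫ x, e x * jumpPrim f x := by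
    rw [hint]
    apply integral_congr_ae
    filter_upwards [hk] with x hx
    rw [hx]
  -- The `-1` produces the constant `∫ f = 𝓕⁻ f 0`, which is minus the jump of `k` at the origin.
  have hI : ∀ t : ℝ, 2 * Real.pi * Complex.I * α * (∫ x in (0 : ℝ)..t, e x) = e t - 1 := by
    intro t
    rw [← intervalIntegral.integral_const_mul]
    have hd : ∀ x : ℝ, HasDerivAt e (2 * Real.pi * Complex.I * α * e x) x := by
      intro x
      have := ((hasDerivAt_id x).ofReal_comp.const_mul (2 * Real.pi * Complex.I * α)).cexp
      simpa [he, mul_comm] using this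
    rw [intervalIntegral.integral_eq_sub_of_hasDerivAt (fun x _ => hd x)
      (Continuous.intervalIntegrable (by fun_prop) _ _)]
    simp [he]
  rw [h1, integral_mul_jumpPrim hprod, h0, hint, mul_neg, ← integral_const_mul,
    ← integral_sub i1 (i1.bdd_mul hec.aestronglyMeasurable (ae_of_all _ hne)), ← integral_neg]
  congr 1; ext t
  rw [← mul_assoc, hI]; ring

end JumpSmooth

end JumpSmooth

/-! ### Bootstrap for the equation on the Fourier side -/

section Bootstrap

theorem fourierInv_add_apply {k l : ℝ → ℂ} (hk : Integrable k) (hl : Integrable l) (α : ℝ) :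
    𝓕⁻ (fun ξ => k ξ + l ξ) α = 𝓕⁻ k α + 𝓕⁻ l α := by
  simp only [Real.fourierInv_eq]
  rw [← integral_add]
  · simp only [smul_add]
  · simpa using (Real.fourierIntegral_convergent_iff (-α)).2 hk
  · simpa using (Real.fourierIntegral_convergent_iff (-α)).2 hl

theorem fourierInv_const_mul_apply (c : ℂ) (k : ℝ → ℂ) (α : ℝ) :
    𝓕⁻ (fun ξ => c * k ξ) α = c * 𝓕⁻ k α := by
  simp only [Real.fourierInv_eq']
  rw [← integral_const_mul]
  congr 1; ext ξ
  simp only [smul_eq_mul]; ring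

theorem weightedL2_two_iff {k : ℝ → ℂ} (hk : AEStronglyMeasurable k volume) :
    WeightedL2 2 k ↔ MemLp (fun ξ : ℝ => ((1 + ξ ^ 2 : ℝ) : ℂ) * k ξ) 2 := by
  have hn : ∀ ξ : ℝ, ‖((1 + ξ ^ 2 : ℝ) : ℂ)‖ = 1 + ξ ^ 2 := fun ξ => by
    rw [Complex.norm_real, Real.norm_of_nonneg (by positivity)]
  have hc : Continuous fun ξ : ℝ => ((1 + ξ ^ 2 : ℝ) : ℂ) := by fun_prop
  constructor
  · intro h
    refine MemLp.of_le h (hc.aestronglyMeasurable.mul hk) (ae_of_all _ fun ξ => ?_)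
    rw [norm_mul, norm_mul, norm_weight, hn]
    gcongr
    nlinarith [abs_nonneg ξ, sq_abs ξ]
  · intro h
    refine MemLp.of_le_mul (c := 2) h ((continuous_weight 2).aestronglyMeasurable.mul hk)
      (ae_of_all _ fun ξ => ?_)
    rw [norm_mul, norm_mul, norm_weight, hn, ← mul_assoc]
    gcongr
    nlinarith [sq_nonneg (|ξ| - 1), sq_abs ξ]

theorem MemH.exists_fourierInv {f : ℝ → ℝ} (hf : MemH 2 f) :
    ∃ k, WeightedL2 2 k ∧ (fun x => (f x : ℂ)) =ᵐ[volume] 𝓕⁻ k := by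
  obtain ⟨F, hF, hs⟩ := hf
  rw [memSobolev_two_iff] at hs
  have hk := (weightedL2_two_iff (Lp.memLp (𝓕 F)).1).2 hs
  refine ⟨_, hk, ?_⟩
  have := Lp.coeFn_fourierInv_ae_eq (𝓕 F) (hk.integrable_of_le one_le_two) (ae_eq_refl _)
  rw [FourierTransform.fourierInv_fourier_eq] at this
  exact hF.symm.trans this

theorem memH_two_of_fourierInv {f : ℝ → ℝ} {k : ℝ → ℂ} (hk : WeightedL2 2 k)
    (h : (fun x => (f x : ℂ)) =ᵐ[volume] 𝓕⁻ k) : MemH 2 f := by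
  have hi := hk.integrable_of_le one_le_two
  have hL := fourierInv_memLp_two hi hk.memLp
  refine ⟨hL.toLp _, hL.coeFn_toLp.trans h.symm, ?_⟩
  rw [memSobolev_two_iff]
  refine (memLp_congr_ae ?_).1 ((weightedL2_two_iff hk.aestronglyMeasurable).1 hk)
  filter_upwards [Lp.coeFn_fourier_ae_eq _ hi hk.memLp hL.coeFn_toLp] with ξ hξ
  rw [hξ]

/-- The Fourier multiplier `|D|` on the Fourier side. -/
noncomputable def absDSymbolMul (k : ℝ → ℂ) (ξ : ℝ) : ℂ :=
  ((2 * Real.pi : ℝ) : ℂ) * (((|ξ| : ℝ) : ℂ) * k ξ)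

theorem WeightedL2.absDSymbolMul {s : ℕ} {k : ℝ → ℂ} (hk : WeightedL2 (s + 1) k) :
    WeightedL2 s (absDSymbolMul k) := hk.abs_mul.const_mul _

theorem JumpSmooth.absDSymbolMul {n : ℕ} {k : ℝ → ℂ} (hk : JumpSmooth 2 n k) :
    JumpSmooth 1 n (absDSymbolMul k) := hk.abs_mul.const_mul _

theorem IsAbsD.ae_eq {f h : ℝ → ℝ} (hfh : IsAbsD f h) {k : ℝ → ℂ} (hk : WeightedL2 2 k)
    (hf : ∀ α, (f α : ℂ) = 𝓕⁻ k α) :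
    (fun x => (h x : ℂ)) =ᵐ[volume] 𝓕⁻ (absDSymbolMul k) := by
  obtain ⟨F, G, hF, hG, hFG⟩ := hfh
  have h1 := Lp.coeFn_fourier_ae_eq F (hk.integrable_of_le one_le_two) hk.memLp
    (hF.trans (ae_of_all _ hf))
  have h2 : ((𝓕 G : Lp ℂ 2 (volume : Measure ℝ)) : ℝ → ℂ) =ᵐ[volume] absDSymbolMul k := by
    filter_upwards [h1, hFG] with ξ h1 h2
    rw [h2, h1, absDSymbolMul]; push_cast; ring
  have h3 := Lp.coeFn_fourierInv_ae_eq (𝓕 G) hk.absDSymbolMul.integrable h2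
  rw [FourierTransform.fourierInv_fourier_eq] at h3
  exact hG.symm.trans h3

/-- Multiplication by `α` is differentiation in frequency, so the transform of `αφ` furnishes the
first derivative of `k`. -/
theorem IsEvenLocalizedH2.exists_jumpSmooth {φ : ℝ → ℝ} (hφ : IsEvenLocalizedH2 φ) :
    ∃ k, JumpSmooth 2 1 k ∧ ∀ α, (φ α : ℂ) = 𝓕⁻ k α := by
  obtain ⟨k, hk, hkφ⟩ := hφ.memH.exists_fourierInv
  obtain ⟨l, hl, hlφ⟩ := hφ.memH_mul.exists_fourierInv
  have ik := hk.integrable_of_le one_le_two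
  have il := hl.integrable_of_le one_le_two
  have hc := hφ.continuous
  have hk' : (fun x => (φ x : ℂ)) = 𝓕⁻ k :=
    (Continuous.ae_eq_iff_eq volume (by fun_prop) (continuous_fourierInv ik)).1 hkφ
  have hl' : (fun x => ((x * φ x : ℝ) : ℂ)) = 𝓕⁻ l :=
    (Continuous.ae_eq_iff_eq volume (by fun_prop) (continuous_fourierInv il)).1 hlφ
  refine ⟨k, ⟨hk, fun ξ => (-(2 * Real.pi * Complex.I)) * l ξ, hl.const_mul _, ?_⟩, congrFun hk'⟩
  -- Here `𝓕⁻ f = -2πi α φ` vanishes at `α = 0`, so `jumpPrim f` has no jump and its inverse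
  -- transform agrees with `φ` for `α ≠ 0`.
  set f : ℝ → ℂ := fun ξ => (-(2 * Real.pi * Complex.I)) * l ξ with hf
  have hfw : WeightedL2 2 f := hl.const_mul _
  have if1 := hfw.integrable_of_le one_le_two
  have if2 := hfw.abs_mul.integrable
  have hJi : Integrable (jumpPrim f) := by
    have := integrable_mul_jumpPrim (M := fun _ => 1) (integrable_prod_jumpKernel_of_bounded
      (f := f) (M := fun _ => 1) if1 if2
      aestronglyMeasurable_const (C := 1) (by simp))
    simpa using this
  have hJ2 : MemLp (jumpPrim f) 2 := by
    rw [memLp_two_iff_integrable_sq_norm hJi.1]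
    simp_rw [pow_two]
    refine hJi.norm.bdd_mul hJi.1.norm (c := ∫ t, ‖f t‖) (ae_of_all _ fun x => ?_)
    rw [norm_norm]
    exact norm_jumpPrim_le f x if1
  refine ae_eq_of_fourierInv_ae_eq ik hk.memLp hJi hJ2 ?_
  have hne : ∀ᵐ α : ℝ, α ≠ 0 := by simp [ae_iff]
  filter_upwards [hne] with α hα
  have h1 := JumpSmooth.fourierInv_jumpPrim hfw (ae_eq_refl (jumpPrim f)) α
  rw [hf, fourierInv_const_mul_apply, fourierInv_const_mul_apply, ← hl', ← hf] at h1
  have h2 : (2 * Real.pi * Complex.I * α : ℂ) ≠ 0 := by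
    have : (α : ℂ) ≠ 0 := by exact_mod_cast hα
    simp [this, Real.pi_ne_zero]
  apply mul_left_cancel₀ h2
  rw [h1, ← hk']
  push_cast
  ring

/-- Regularity of the Fourier transform away from the origin for solutions of equations
`A φ + B |D| φ = N(φ)` with quadratic and cubic terms of the type occurring in the Babenko
equation. -/
theorem jumpSmooth_of_equation {φ d₁ d₂ d₃ : ℝ → ℝ} {k : ℝ → ℂ} (hk : JumpSmooth 2 1 k)
    (hφ : ∀ α, (φ α : ℂ) = 𝓕⁻ k α) (h₁ : IsAbsD φ d₁) (h₂ : IsAbsD (fun α => φ α ^ 2) d₂)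
    (h₃ : IsAbsD (fun α => φ α ^ 3) d₃) {A B p q₁ q₂ r₁ r₂ r₃ : ℝ} (hA : 0 < A) (hB : 0 < B)
    (heq : ∀ᵐ α : ℝ, A * φ α + B * d₁ α = p * φ α ^ 2 + q₁ * (φ α * d₁ α) + q₂ * d₂ α
      + r₁ * (φ α * d₂ α) + r₂ * (φ α ^ 2 * d₁ α) + r₃ * d₃ α) (n : ℕ) : JumpSmooth 2 n k := by
  set k₂ := conv k k with hk₂
  set k₃ := conv k₂ k with hk₃
  set Q : ℝ → ℂ := fun ξ => p * k₂ ξ + q₁ * conv k (absDSymbolMul k) ξ + q₂ * absDSymbolMul k₂ ξ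
    + r₁ * conv k (absDSymbolMul k₂) ξ + r₂ * conv k₂ (absDSymbolMul k) ξ
    + r₃ * absDSymbolMul k₃ ξ with hQ
  -- Every term of `Q` contains a convolution, hence gains a derivative; the factors `|ξ|` leave
  -- only weight `1`.
  have hQreg : ∀ n, JumpSmooth 2 (n + 1) k → JumpSmooth 1 (n + 2) Q := by
    intro n hn
    have j2 : JumpSmooth 2 (n + 2) k₂ := hn.conv_gain one_le_two hn
    have j3 : JumpSmooth 2 (n + 2) k₃ := j2.pred.conv_gain one_le_two hn
    have w1 := hn.mono_weight one_le_two
    have w2 := j2.mono_weight one_le_two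
    have m1 := hn.absDSymbolMul
    have m2 := j2.absDSymbolMul
    exact (((((w2.const_mul p).add le_rfl ((w1.conv_gain le_rfl m1).const_mul q₁)).add le_rfl
      (m2.const_mul q₂)).add le_rfl ((w1.conv_gain le_rfl m2.pred).const_mul r₁)).add le_rfl
      ((w2.pred.conv_gain le_rfl m1).const_mul r₂)).add le_rfl (j3.absDSymbolMul.const_mul r₃)
  have w1 : WeightedL2 2 k := hk.weightedL2
  have w2 : WeightedL2 2 k₂ := w1.conv one_le_two w1
  have w3 : WeightedL2 2 k₃ := w2.conv one_le_two w1
  have i1 := w1.integrable_of_le one_le_two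
  have i2 := w2.integrable_of_le one_le_two
  have m1 := w1.absDSymbolMul.integrable
  have m2 := w2.absDSymbolMul.integrable
  have m3 := w3.absDSymbolMul.integrable
  have c1 := integrable_conv i1 m1
  have c2 := integrable_conv i1 m2
  have c3 := integrable_conv i2 m1
  have hφ2 : ∀ α, ((φ α ^ 2 : ℝ) : ℂ) = 𝓕⁻ k₂ α := fun α => by
    rw [hk₂, fourierInv_conv i1 i1, ← hφ]; push_cast; ring
  have hφ3 : ∀ α, ((φ α ^ 3 : ℝ) : ℂ) = 𝓕⁻ k₃ α := fun α => by
    rw [hk₃, fourierInv_conv i2 i1, ← hφ, ← hφ2]; push_cast; ring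
  have hQw : WeightedL2 1 Q := (hQreg 0 hk).weightedL2
  have hP : WeightedL2 1 (fun ξ => A * k ξ + B * absDSymbolMul k ξ) :=
    ((w1.mono one_le_two).const_mul A).add (w1.absDSymbolMul.const_mul B)
  have hPQ : (fun ξ => A * k ξ + B * absDSymbolMul k ξ) =ᵐ[volume] Q := by
    refine ae_eq_of_fourierInv_ae_eq hP.integrable (hP.memLp) hQw.integrable
      hQw.memLp ?_
    filter_upwards [heq, h₁.ae_eq w1 hφ, h₂.ae_eq w2 hφ2, h₃.ae_eq w3 hφ3] with α e e1 e2 e3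
    have e' := congrArg (fun x : ℝ => (x : ℂ)) e
    push_cast at e'
    have t1 := (i2.const_mul (p : ℂ))
    have t2 := t1.fun_add (c1.const_mul (q₁ : ℂ))
    have t3 := t2.fun_add (m2.const_mul (q₂ : ℂ))
    have t4 := t3.fun_add (c2.const_mul (r₁ : ℂ))
    have t5 := t4.fun_add (c3.const_mul (r₂ : ℂ))
    have hR : 𝓕⁻ Q α = p * 𝓕⁻ k₂ α + q₁ * 𝓕⁻ (conv k (absDSymbolMul k)) α
        + q₂ * 𝓕⁻ (absDSymbolMul k₂) α + r₁ * 𝓕⁻ (conv k (absDSymbolMul k₂)) α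
        + r₂ * 𝓕⁻ (conv k₂ (absDSymbolMul k)) α + r₃ * 𝓕⁻ (absDSymbolMul k₃) α := by
      rw [← fourierInv_const_mul_apply, ← fourierInv_const_mul_apply, ← fourierInv_const_mul_apply,
        ← fourierInv_const_mul_apply, ← fourierInv_const_mul_apply, ← fourierInv_const_mul_apply,
        ← fourierInv_add_apply t1 (c1.const_mul _), ← fourierInv_add_apply t2 (m2.const_mul _),
        ← fourierInv_add_apply t3 (c2.const_mul _), ← fourierInv_add_apply t4 (c3.const_mul _),
        ← fourierInv_add_apply t5 (m3.const_mul _)]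
    rw [hR, fourierInv_add_apply (i1.const_mul _) (m1.const_mul _), fourierInv_const_mul_apply,
      fourierInv_const_mul_apply, fourierInv_conv i1 m1, fourierInv_conv i1 m2,
      fourierInv_conv i2 m1, ← e1, ← e2, ← e3, ← hφ, ← hφ2, e']
    push_cast
    rfl
  have hkQ : k =ᵐ[volume] fun ξ => resolventSymbol A (2 * Real.pi * B) ξ * Q ξ := by
    filter_upwards [hPQ] with ξ hξ
    have hpos : (A + 2 * Real.pi * B * |ξ| : ℝ) ≠ 0 := by positivity
    have hpos' : (A + 2 * Real.pi * B * |ξ| : ℂ) ≠ 0 := by exact_mod_cast hpos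
    rw [← hξ, resolventSymbol, absDSymbolMul]
    push_cast
    field_simp
  -- Orders `0` and `1` are the hypothesis: the gain under convolution needs one derivative to start
  -- from.
  induction n with
  | zero => exact hk.weightedL2
  | succ n ih =>
    cases n with
    | zero => exact hk
    | succ n => exact ((hQreg n ih).resolventSymbol_mul hA (by positivity)).congr hkQ.symm

end Bootstrap

/-! ### Asymptotic expansion in powers of a Lorentzian -/

section Expansion

/-- Inverse Fourier integrals of functions in `WeightedL2 2`, that is, continuous
representatives of complex-valued elements of `H²`. -/
def IsH2Function (w : ℝ → ℂ) : Prop := ∃ k, WeightedL2 2 k ∧ ∀ α, w α = 𝓕⁻ k α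

namespace IsH2Function

variable {u w : ℝ → ℂ}

theorem add (hu : IsH2Function u) (hw : IsH2Function w) : IsH2Function (fun α => u α + w α) := by
  obtain ⟨k, hk, hku⟩ := hu
  obtain ⟨l, hl, hlw⟩ := hw
  refine ⟨_, hk.add hl, fun α => ?_⟩
  simp only [hku, hlw]
  rw [fourierInv_add_apply (hk.integrable_of_le one_le_two) (hl.integrable_of_le one_le_two)]

theorem const_mul (hu : IsH2Function u) (c : ℂ) : IsH2Function (fun α => c * u α) := by
  obtain ⟨k, hk, hku⟩ := hu
  exact ⟨_, hk.const_mul c, fun α => by simp only [fourierInv_const_mul_apply, hku]⟩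

theorem mul (hu : IsH2Function u) (hw : IsH2Function w) : IsH2Function (fun α => u α * w α) := by
  obtain ⟨k, hk, hku⟩ := hu
  obtain ⟨l, hl, hlw⟩ := hw
  refine ⟨_, hk.conv one_le_two hl, fun α => ?_⟩
  simp only [hku, hlw]
  rw [fourierInv_conv (hk.integrable_of_le one_le_two) (hl.integrable_of_le one_le_two)]

theorem star (hu : IsH2Function u) : IsH2Function (fun α => (starRingEnd ℂ) (u α)) := by
  obtain ⟨k, hk, hku⟩ := hu
  refine ⟨_, hk.star.comp_neg, fun α => ?_⟩
  simp only [hku]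
  rw [Real.fourierInv_eq', Real.fourierInv_eq', ← integral_conj,
    ← integral_neg_eq_self (fun v : ℝ => Complex.exp (↑(2 * Real.pi * inner ℝ v α) * Complex.I) •
      (starRingEnd ℂ) (k (-v)))]
  congr 1; ext v
  simp [← Complex.exp_conj, Complex.conj_ofNat]

theorem memH_re (hu : IsH2Function u) : MemH 2 (fun α => (u α).re) := by
  obtain ⟨k, hk, hku⟩ := (hu.add hu.star).const_mul (1 / 2)
  refine memH_two_of_fourierInv hk (ae_of_all _ fun α => ?_)
  simp only [Complex.re_eq_add_conj, ← hku]
  ring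

theorem tendsto_zero (hu : IsH2Function u) : Tendsto u (cocompact ℝ) (𝓝 0) := by
  obtain ⟨k, -, hku⟩ := hu
  rw [funext hku]
  exact tendsto_fourierInv_cocompact k

theorem exists_bound (hu : IsH2Function u) : ∃ C, ∀ α, ‖u α‖ ≤ C := by
  obtain ⟨k, -, hku⟩ := hu
  refine ⟨∫ ξ, ‖k ξ‖, fun α => ?_⟩
  rw [hku, Real.fourierInv_eq]
  exact (norm_integral_le_integral_norm _).trans (by simp)

end IsH2Function

theorem integrable_exp_neg_mul_abs {b : ℝ} (hb : 0 < b) :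
    Integrable fun ξ : ℝ => Real.exp (-b * |ξ|) := by
  rw [← integrableOn_univ, ← Set.Iic_union_Ioi (a := (0 : ℝ))]
  refine IntegrableOn.union ?_ ?_
  · refine (integrableOn_exp_mul_Iic hb 0).congr_fun (fun ξ hξ => ?_) measurableSet_Iic
    simp only [abs_of_nonpos (Set.mem_Iic.1 hξ), neg_mul_neg]
  · refine (integrableOn_exp_mul_Ioi (neg_lt_zero.2 hb) 0).congr_fun (fun ξ hξ => ?_)
      measurableSet_Ioi
    simp only [abs_of_pos (Set.mem_Ioi.1 hξ)]

theorem weightedL2_exp_neg_mul_abs {b : ℝ} (hb : 0 < b) :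
    WeightedL2 2 fun ξ : ℝ => ((Real.exp (-b * |ξ|) : ℝ) : ℂ) := by
  have hc : Continuous fun ξ : ℝ =>
      (((1 + |ξ|) ^ 2 : ℝ) : ℂ) * ((Real.exp (-b * |ξ|) : ℝ) : ℂ) := by
    fun_prop
  rw [WeightedL2, memLp_two_iff_integrable_sq_norm hc.aestronglyMeasurable]
  refine ((integrable_exp_neg_mul_abs hb).const_mul (((4 / b) ^ 2 * Real.exp (b / 2)) ^ 2)).mono'
    (by fun_prop) (ae_of_all _ fun ξ => ?_)
  rw [norm_mul, norm_weight, Complex.norm_real, Real.norm_of_nonneg (Real.exp_nonneg _),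
    Real.norm_of_nonneg (by positivity)]
  -- The rate `b / 4` makes the squared weight cost `exp (b|ξ|)`, against `exp (-2b|ξ|)` available,
  -- leaving the integrable `exp (-b|ξ|)`.
  have h1 : b / 4 * (1 + |ξ|) ≤ Real.exp (b / 4 * (1 + |ξ|)) :=
    (by linarith : b / 4 * (1 + |ξ|) ≤ b / 4 * (1 + |ξ|) + 1).trans (Real.add_one_le_exp _)
  have h2 : (1 + |ξ|) ^ 2 ≤ (4 / b) ^ 2 * (Real.exp (b / 2) * Real.exp (b / 2 * |ξ|)) := by
    have h3 : (b / 4 * (1 + |ξ|)) ^ 2 ≤ Real.exp (b / 4 * (1 + |ξ|)) ^ 2 :=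
      pow_le_pow_left₀ (by positivity) h1 2
    rw [← Real.exp_nat_mul] at h3
    have e : ((2 : ℕ) : ℝ) * (b / 4 * (1 + |ξ|)) = b / 2 + b / 2 * |ξ| := by push_cast; ring
    rw [e, Real.exp_add] at h3
    calc (1 + |ξ|) ^ 2 = (4 / b) ^ 2 * (b / 4 * (1 + |ξ|)) ^ 2 := by field_simp
      _ ≤ _ := by gcongr
  calc ((1 + |ξ|) ^ 2 * Real.exp (-b * |ξ|)) ^ 2
      ≤ ((4 / b) ^ 2 * (Real.exp (b / 2) * Real.exp (b / 2 * |ξ|)) * Real.exp (-b * |ξ|)) ^ 2 := by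
        gcongr
    _ = ((4 / b) ^ 2 * Real.exp (b / 2)) ^ 2 *
        (Real.exp (b / 2 * |ξ|) * Real.exp (-b * |ξ|)) ^ 2 := by ring
    _ = _ := by
        rw [← Real.exp_add, ← Real.exp_nat_mul]
        congr 2
        push_cast; ring

theorem fourierInv_exp_neg_mul_abs {b : ℝ} (hb : 0 < b) (α : ℝ) :
    𝓕⁻ (fun ξ : ℝ => ((Real.exp (-b * |ξ|) : ℝ) : ℂ)) α =
      ((2 * b / (b ^ 2 + (2 * Real.pi * α) ^ 2) : ℝ) : ℂ) := by
  set z : ℂ := ((2 * Real.pi * α : ℝ) : ℂ) * Complex.I with hz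
  have hre : z.re = 0 := by simp [hz]
  have r1 : (-(b : ℂ) + z).re < 0 := by simp [hre, hb]
  have r2 : 0 < ((b : ℂ) + z).re := by simp [hre, hb]
  have e1 : ∀ ξ ∈ Set.Ioi (0 : ℝ), Complex.exp (↑(2 * Real.pi * inner ℝ ξ α) * Complex.I) •
      ((Real.exp (-b * |ξ|) : ℝ) : ℂ) = Complex.exp ((-(b : ℂ) + z) * ξ) := by
    intro ξ hξ
    rw [abs_of_pos hξ, smul_eq_mul, Complex.ofReal_exp, ← Complex.exp_add, hz]
    congr 1
    simp
    ring
  have e2 : ∀ ξ ∈ Set.Iic (0 : ℝ), Complex.exp (↑(2 * Real.pi * inner ℝ ξ α) * Complex.I) •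
      ((Real.exp (-b * |ξ|) : ℝ) : ℂ) = Complex.exp (((b : ℂ) + z) * ξ) := by
    intro ξ hξ
    rw [abs_of_nonpos hξ, smul_eq_mul, Complex.ofReal_exp, ← Complex.exp_add, hz]
    congr 1
    simp
    ring
  have i1 := (integrableOn_exp_mul_complex_Ioi r1 0).congr_fun (fun ξ hξ => (e1 ξ hξ).symm)
    measurableSet_Ioi
  have i2 := (integrableOn_exp_mul_complex_Iic r2 0).congr_fun (fun ξ hξ => (e2 ξ hξ).symm)
    measurableSet_Iic
  rw [Real.fourierInv_eq', ← intervalIntegral.integral_Iic_add_Ioi i2 i1,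
    setIntegral_congr_fun measurableSet_Ioi e1, setIntegral_congr_fun measurableSet_Iic e2,
    integral_exp_mul_complex_Ioi r1, integral_exp_mul_complex_Iic r2]
  have n1 : -(b : ℂ) + z ≠ 0 := fun h => by rw [h] at r1; simp at r1
  have n2 : (b : ℂ) + z ≠ 0 := fun h => by rw [h] at r2; simp at r2
  have hz2 : z ^ 2 = -((2 * Real.pi * α) ^ 2 : ℂ) := by
    rw [hz, mul_pow, Complex.I_sq]; push_cast; ring
  have n3 : (b : ℂ) ^ 2 + (2 * Real.pi * α) ^ 2 ≠ 0 := by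
    have : b ^ 2 + (2 * Real.pi * α) ^ 2 ≠ 0 := by positivity
    exact_mod_cast this
  have n4 : (b : ℂ) ^ 2 + (2 * Real.pi * α) ^ 2 = -((b + z) * (-b + z)) := by
    linear_combination hz2
  push_cast
  rw [n4]
  simp
  field_simp
  ring

theorem isH2Function_lorentzian {lam : ℝ} (hlam : 0 < lam) :
    IsH2Function fun α => (((1 + (lam * α) ^ 2)⁻¹ : ℝ) : ℂ) := by
  -- This rate gives the Lorentzian the width `1/lam`; its height is then `lam/π`, whence the
  -- prefactor.
  have hb : 0 < 2 * Real.pi / lam := by positivity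
  refine ⟨_, (weightedL2_exp_neg_mul_abs hb).const_mul ((Real.pi / lam : ℝ) : ℂ), fun α => ?_⟩
  rw [fourierInv_const_mul_apply, fourierInv_exp_neg_mul_abs hb, ← Complex.ofReal_mul]
  have h1 : 1 + (lam * α) ^ 2 ≠ 0 := by positivity
  have h2 : (2 * Real.pi / lam) ^ 2 + (2 * Real.pi * α) ^ 2 =
      (2 * Real.pi / lam) ^ 2 * (1 + (lam * α) ^ 2) := by
    field_simp
  rw [h2]
  field_simp

/-- Even functions whose Fourier transform is smooth away from the origin, with all derivatives in
`WeightedL2 2`. -/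
structure IsEvenJumpSmooth (u : ℝ → ℂ) : Prop where
  even : ∀ α, u (-α) = u α
  jumpSmooth : ∀ n, ∃ k, JumpSmooth 2 n k ∧ ∀ α, u α = 𝓕⁻ k α

theorem IsEvenJumpSmooth.isH2Function {u : ℝ → ℂ} (hu : IsEvenJumpSmooth u) : IsH2Function u :=
  hu.jumpSmooth 0

theorem eq_zero_of_tendsto_const {c : ℂ} {u : ℝ → ℂ} (hu : Tendsto u (cocompact ℝ) (𝓝 0))
    (h : ∀ α, u α = c) : c = 0 := by
  rw [funext h] at hu
  exact tendsto_nhds_unique tendsto_const_nhds hu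

/-- One step of the expansion: the only obstruction to decay is a multiple of `⟨α⟩⁻²`. -/
theorem IsEvenJumpSmooth.exists_mul_eq {u : ℝ → ℂ} (hu : IsEvenJumpSmooth u) (lam : ℝ) :
    ∃ (c : ℂ) (v : ℝ → ℂ), IsEvenJumpSmooth v ∧
      ∀ α : ℝ, ((1 + (lam * α) ^ 2 : ℝ) : ℂ) * u α = c + v α := by
  have step : ∀ n, ∃ (c : ℂ) (k : ℝ → ℂ), JumpSmooth 2 n k ∧
      ∀ α : ℝ, ((1 + (lam * α) ^ 2 : ℝ) : ℂ) * u α = c + 𝓕⁻ k α := by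
    intro n
    obtain ⟨k, hk, hku⟩ := hu.jumpSmooth (n + 2)
    obtain ⟨-, k₁, hk₁, e1⟩ := id hk
    obtain ⟨-, k₂, hk₂, e2⟩ := id hk₁
    have f1 := JumpSmooth.fourierInv_jumpPrim hk₁.weightedL2 e1
    have f2 := JumpSmooth.fourierInv_jumpPrim hk₂.weightedL2 e2
    -- Adding the identity at `α` and `-α`, evenness of `u` cancels the left sides, and
    -- Riemann–Lebesgue forces the constant to vanish.
    have h0 : 𝓕⁻ k₁ 0 = 0 := by
      have ht := tendsto_fourierInv_cocompact k₁
      have ht' : Tendsto (fun α => 𝓕⁻ k₁ (-α)) (cocompact ℝ) (𝓝 0) :=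
        ht.comp (Homeomorph.neg ℝ).isClosedEmbedding.tendsto_cocompact
      have := ht.add ht'
      rw [add_zero] at this
      have h2 := eq_zero_of_tendsto_const (c := 2 * 𝓕⁻ k₁ 0) this fun α => by
        have g1 := f1 α
        have g2 := f1 (-α)
        rw [← hku] at g1 g2
        rw [hu.even] at g2
        push_cast at g2
        linear_combination g1 + g2
      simpa using h2
    have hpi : (Real.pi : ℂ) ≠ 0 := by exact_mod_cast Real.pi_ne_zero
    refine ⟨lam ^ 2 / (4 * Real.pi ^ 2) * 𝓕⁻ k₂ 0,
      fun ξ => k ξ + (-(lam ^ 2 / (4 * Real.pi ^ 2)) : ℂ) * k₂ ξ,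
      hk.pred.pred.add one_le_two (hk₂.const_mul _), fun α => ?_⟩
    rw [fourierInv_add_apply (hk.weightedL2.integrable_of_le one_le_two)
      ((hk₂.weightedL2.integrable_of_le one_le_two).const_mul _), fourierInv_const_mul_apply, ← hku]
    have g1 := f1 α
    have g2 := f2 α
    rw [h0, ← hku] at g1
    have hI := Complex.I_sq
    have key : 4 * (Real.pi : ℂ) ^ 2 * α ^ 2 * u α = 𝓕⁻ k₂ 0 - 𝓕⁻ k₂ α := by
      linear_combination g2 - 2 * Real.pi * Complex.I * α * g1
        + 4 * (Real.pi : ℂ) ^ 2 * α ^ 2 * u α * hI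
    push_cast
    field_simp
    linear_combination (lam : ℂ) ^ 2 * key
  obtain ⟨c, k, hk, hck⟩ := step 0
  refine ⟨c, 𝓕⁻ k, ⟨fun α => ?_, fun n => ?_⟩, hck⟩
  · have h1 := hck α
    have h2 := hck (-α)
    rw [hu.even, mul_neg, neg_sq, h1] at h2
    exact (add_left_cancel h2).symm
  · obtain ⟨c', k', hk', hck'⟩ := step n
    have ht := (tendsto_fourierInv_cocompact k).sub (tendsto_fourierInv_cocompact k')
    rw [sub_zero] at ht
    -- The constant is the limit of the left side at infinity, so it does not depend on `n`; thus
    -- one `v` serves all orders.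
    have h2 := eq_zero_of_tendsto_const (c := c' - c) ht fun α => by
      linear_combination hck' α - hck α
    refine ⟨k', hk', fun α => ?_⟩
    linear_combination hck' α - hck α + h2

theorem IsEvenJumpSmooth.exists_expansion {u : ℝ → ℂ} (hu : IsEvenJumpSmooth u) (lam : ℝ) :
    ∃ (c : ℕ → ℂ) (v : ℕ → ℝ → ℂ), (∀ n, IsEvenJumpSmooth (v n)) ∧ ∀ N α,
      u α = ∑ j ∈ Finset.Icc 1 N, c j * (((1 + (lam * α) ^ 2)⁻¹ : ℝ) : ℂ) ^ j +
        (((1 + (lam * α) ^ 2)⁻¹ : ℝ) : ℂ) ^ N * v N α := by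
  choose! C V hV hCV using fun (u : ℝ → ℂ) (hu : IsEvenJumpSmooth u) => hu.exists_mul_eq lam
  set v : ℕ → ℝ → ℂ := fun n => V^[n] u with hv
  have hvn : ∀ n, IsEvenJumpSmooth (v n) := by
    intro n
    induction n with
    | zero => exact hu
    | succ n ih =>
      simp only [hv, Function.iterate_succ_apply']
      exact hV _ ih
  refine ⟨fun n => C (v (n - 1)), v, hvn, fun N α => ?_⟩
  induction N with
  | zero => simp [hv]
  | succ N ih =>
    rw [Finset.sum_Icc_succ_top (by omega), add_assoc]
    conv_lhs => rw [ih]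
    congr 1
    have h := hCV _ (hvn N) α
    have hs : v (N + 1) = V (v N) := by simp only [hv, Function.iterate_succ_apply']
    have hne : ((1 + (lam * α) ^ 2 : ℝ) : ℂ) ≠ 0 := by
      have : 1 + (lam * α) ^ 2 ≠ 0 := by positivity
      exact_mod_cast this
    have h' : v N α = (((1 + (lam * α) ^ 2)⁻¹ : ℝ) : ℂ) * (C (v N) + V (v N) α) := by
      rw [Complex.ofReal_inv, ← h, inv_mul_cancel_left₀ hne]
    simp only [Nat.add_sub_cancel, hs]
    rw [h']
    ring

theorem bracket_rpow (N : ℕ) (α : ℝ) : bracket α ^ (2 * N : ℝ) = (1 + α ^ 2) ^ N := by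
  rw [bracket, Real.rpow_mul (Real.sqrt_nonneg _), Real.rpow_natCast, Real.rpow_two,
    Real.sq_sqrt (by positivity)]

theorem bracket_rpow_neg (N : ℕ) (α : ℝ) : bracket α ^ (-(2 * N : ℝ)) = ((1 + α ^ 2)⁻¹) ^ N := by
  rw [Real.rpow_neg (by unfold bracket; positivity), bracket_rpow, inv_pow]

/-- The ratio is a constant plus a multiple of a Lorentzian, and `H²` is an algebra. This exchanges
the weight `1 + (lam α)²` for `1 + α²`. -/
theorem IsH2Function.mul_ratio_pow {w : ℝ → ℂ} (hw : IsH2Function w) {lam : ℝ} (hlam : 0 < lam)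
    (N : ℕ) : IsH2Function fun α => (((1 + α ^ 2) * (1 + (lam * α) ^ 2)⁻¹ : ℝ) : ℂ) ^ N * w α := by
  have h1 : ∀ {w : ℝ → ℂ}, IsH2Function w →
      IsH2Function fun α => (((1 + α ^ 2) * (1 + (lam * α) ^ 2)⁻¹ : ℝ) : ℂ) * w α := by
    intro w hw
    have := (hw.const_mul ((lam ^ 2)⁻¹ : ℝ)).add
      (((isH2Function_lorentzian hlam).mul hw).const_mul (1 - (lam ^ 2)⁻¹ : ℝ))
    convert this using 2 with α
    have h : 1 + (lam * α) ^ 2 ≠ 0 := by positivity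
    have e : (1 + α ^ 2) * (1 + (lam * α) ^ 2)⁻¹ =
        (lam ^ 2)⁻¹ + (1 - (lam ^ 2)⁻¹) * (1 + (lam * α) ^ 2)⁻¹ := by
      field_simp
      ring
    rw [e]
    push_cast
    ring
  induction N with
  | zero => simpa using hw
  | succ N ih =>
    convert h1 ih using 2 with α
    rw [pow_succ]; ring

/-- The asymptotic expansion in powers of a Lorentzian. -/
theorem IsEvenJumpSmooth.exists_real_expansion {φ : ℝ → ℝ}
    (hφ : IsEvenJumpSmooth fun α => (φ α : ℂ)) {lam : ℝ} (hlam : 0 < lam) :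
    ∃ c : ℕ → ℝ, ∀ N : ℕ, ∃ gN : ℝ → ℝ, MemHWeighted 2 (2 * N) gN ∧
      (∀ α, φ α = ∑ j ∈ Finset.Icc 1 N, c j * ((1 + (lam * α) ^ 2)⁻¹) ^ j + gN α) ∧
      gN =o[cocompact ℝ] (fun α => bracket α ^ (-(2 * N : ℝ))) := by
  obtain ⟨c, v, hv, hcv⟩ := hφ.exists_expansion lam
  refine ⟨fun j => (c j).re, fun N =>
    ⟨fun α => ((1 + (lam * α) ^ 2)⁻¹) ^ N * (v N α).re, ?_, fun α => ?_, ?_⟩⟩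
  · have := ((hv N).isH2Function.mul_ratio_pow hlam N).memH_re
    unfold MemHWeighted
    convert this using 2 with α
    rw [bracket_rpow, ← Complex.ofReal_pow, Complex.re_ofReal_mul, mul_pow]
    ring
  · have := congrArg Complex.re (hcv N α)
    simp only [Complex.ofReal_re, Complex.add_re, Complex.re_sum, ← Complex.ofReal_pow,
      Complex.re_ofReal_mul, Complex.re_mul_ofReal] at this
    exact this
  · have h1 : (fun α : ℝ => ((1 + (lam * α) ^ 2)⁻¹) ^ N) =O[cocompact ℝ]
        fun α => bracket α ^ (-(2 * N : ℝ)) := by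
      refine IsBigO.of_bound ((1 + (lam ^ 2)⁻¹) ^ N) (Eventually.of_forall fun α => ?_)
      rw [bracket_rpow_neg, Real.norm_of_nonneg (by positivity), Real.norm_of_nonneg (by positivity),
        ← mul_pow]
      refine pow_le_pow_left₀ (by positivity) ?_ N
      rw [← div_eq_mul_inv, le_div_iff₀ (by positivity), ← div_eq_inv_mul,
        div_le_iff₀ (by positivity)]
      have e : (1 + (lam ^ 2)⁻¹) * (1 + (lam * α) ^ 2) =
          1 + α ^ 2 + ((lam * α) ^ 2 + (lam ^ 2)⁻¹) := by
        field_simp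
        ring
      rw [e]
      have : 0 ≤ (lam * α) ^ 2 + (lam ^ 2)⁻¹ := by positivity
      linarith
    have h2 : (fun α => (v N α).re) =o[cocompact ℝ] fun _ => (1 : ℝ) := by
      rw [isLittleO_one_iff]
      exact (Complex.continuous_re.tendsto' 0 0 rfl).comp (hv N).isH2Function.tendsto_zero
    simpa using h1.mul_isLittleO h2

theorem IsEvenJumpSmooth.exists_bound {φ : ℝ → ℝ} (hφ : IsEvenJumpSmooth fun α => (φ α : ℂ)) :
    ∃ C : ℝ, ∀ α, |φ α| ≤ C * (1 + α ^ 2)⁻¹ := by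
  obtain ⟨c, v, hv, hcv⟩ := hφ.exists_mul_eq 1
  obtain ⟨C, hC⟩ := hv.isH2Function.exists_bound
  refine ⟨‖c‖ + C, fun α => ?_⟩
  rw [← div_eq_mul_inv, le_div_iff₀ (by positivity)]
  have h := congrArg norm (hcv α)
  rw [norm_mul, Complex.norm_real, Complex.norm_real, one_mul,
    Real.norm_of_nonneg (by positivity), Real.norm_eq_abs] at h
  rw [mul_comm, h]
  exact (norm_add_le _ _).trans (by gcongr; exact hC α)

/-- A common form for both Babenko equations; the single `k` found at the start works for every
order. -/
theorem isEvenJumpSmooth_of_equation {φ d₁ d₂ d₃ : ℝ → ℝ} (hφ : IsEvenLocalizedH2 φ)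
    (h₁ : IsAbsD φ d₁) (h₂ : IsAbsD (fun α => φ α ^ 2) d₂)
    (h₃ : IsAbsD (fun α => φ α ^ 3) d₃) {A B p q₁ q₂ r₁ r₂ r₃ : ℝ} (hA : 0 < A) (hB : 0 < B)
    (heq : ∀ᵐ α : ℝ, A * φ α + B * d₁ α = p * φ α ^ 2 + q₁ * (φ α * d₁ α) + q₂ * d₂ α
      + r₁ * (φ α * d₂ α) + r₂ * (φ α ^ 2 * d₁ α) + r₃ * d₃ α) :
    IsEvenJumpSmooth fun α => (φ α : ℂ) := by
  obtain ⟨k, hk, hkφ⟩ := hφ.exists_jumpSmooth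
  exact ⟨fun α => by rw [hφ.even],
    fun n => ⟨k, jumpSmooth_of_equation hk hkφ h₁ h₂ h₃ hA hB heq n, hkφ⟩⟩

theorem IsEvenJumpSmooth.exists_bracket_expansion {φ : ℝ → ℝ}
    (hφ : IsEvenJumpSmooth fun α => (φ α : ℂ)) :
    ∃ d : ℕ → ℝ, ∀ N : ℕ, 1 ≤ N → MemHWeighted 2 (2 * N)
      (fun α => φ α - ∑ k ∈ Finset.Icc 1 N, d k * bracket α ^ (-(2 * k : ℝ))) := by
  obtain ⟨c, hc⟩ := hφ.exists_real_expansion one_pos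
  refine ⟨c, fun N _ => ?_⟩
  obtain ⟨gN, hg, hφg, -⟩ := hc N
  convert hg using 2 with α
  rw [hφg α]
  simp only [bracket_rpow_neg, one_mul, add_sub_cancel_left]

theorem lorentzian_pow_eq_rho (x : ℝ) (j : ℕ) : ((1 + x ^ 2)⁻¹) ^ j = (4 ^ j)⁻¹ * rho x ^ j := by
  rw [rho, div_pow, inv_pow]
  field_simp

end Expansion

/-! ### Application to the two Babenko equations -/

theorem theorem3 :
    -- the rescaled form
    (∀ (ε : ℝ) (φ : ℝ → ℝ), 0 < ε → IsEvenLocalizedH2 φ → SolvesRescaledBabenko ε φ →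
      (∃ a : ℕ → ℝ, ∀ N : ℕ, 1 ≤ N → ∃ gN : ℝ → ℝ,
        MemHWeighted 2 (2 * N) gN ∧
        (∀ α, φ α = rho α + ∑ j ∈ Finset.Icc 1 N, a j * rho α ^ j + gN α) ∧
        gN =o[cocompact ℝ] (fun α => bracket α ^ (-(2 * N : ℝ)))) ∧
      (∃ d : ℕ → ℝ, ∀ N : ℕ, 1 ≤ N →
        MemHWeighted 2 (2 * N)
          (fun α => φ α - ∑ k ∈ Finset.Icc 1 N, d k * bracket α ^ (-(2 * k : ℝ)))) ∧
      (∃ C : ℝ, ∀ α, |φ α| ≤ C * (1 + α ^ 2)⁻¹)) ∧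
    -- the form in the original variables
    (∀ (g γ c ε : ℝ) (U : ℝ → ℝ), 0 < g → γ ≠ 0 → g + c * γ < 0 → ε = |g / γ + c| →
      IsEvenLocalizedH2 U → SolvesBabenko g γ c U →
      (∃ b : ℕ → ℝ, ∀ N : ℕ, 1 ≤ N → ∃ gN : ℝ → ℝ,
        MemHWeighted 2 (2 * N) gN ∧
        (∀ α, U α = ∑ k ∈ Finset.Icc 1 N, b k * rho (ε * α / (1 + ε) ^ 2) ^ k + gN α) ∧
        gN =o[cocompact ℝ] (fun α => bracket α ^ (-(2 * N : ℝ)))) ∧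
      (∃ d : ℕ → ℝ, ∀ N : ℕ, 1 ≤ N →
        MemHWeighted 2 (2 * N)
          (fun α => U α - ∑ k ∈ Finset.Icc 1 N, d k * bracket α ^ (-(2 * k : ℝ)))) ∧
      (∃ C : ℝ, ∀ α, |U α| ≤ C * (1 + α ^ 2)⁻¹)) := by
  refine ⟨fun ε φ hε hφ hsol => ?_, fun g γ c ε U hg hγ hgc hε hU hsol => ?_⟩
  · obtain ⟨d₁, d₂, d₃, h₁, h₂, h₃, heq⟩ := hsol
    have hS := isEvenJumpSmooth_of_equation hφ h₁ h₂ h₃ (A := 1) (B := 1) (p := 1 / 2)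
      (q₁ := ε / (1 + ε) ^ 2) (q₂ := ε / (1 + ε) ^ 2 / 2) (r₁ := -(ε ^ 2 / (1 + ε) ^ 2 / 2))
      (r₂ := ε ^ 2 / (1 + ε) ^ 2 / 2) (r₃ := ε ^ 2 / (1 + ε) ^ 2 / 6) one_pos one_pos (by
        filter_upwards [heq] with α h
        linear_combination -h)
    refine ⟨?_, hS.exists_bracket_expansion, hS.exists_bound⟩
    obtain ⟨a, ha⟩ := hS.exists_real_expansion one_pos
    -- The powers of `4` come from `rho = 4 (1 + α²)⁻¹`; the first coefficient drops by `1` because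
    -- `rho` is displayed separately.
    refine ⟨fun j => a j * (4 ^ j)⁻¹ - if j = 1 then 1 else 0, fun N hN => ?_⟩
    obtain ⟨gN, hgN, hφg, ho⟩ := ha N
    refine ⟨gN, hgN, fun α => ?_, ho⟩
    rw [hφg α]
    simp only [one_mul, lorentzian_pow_eq_rho, sub_mul, Finset.sum_sub_distrib, ite_mul, zero_mul,
      Finset.sum_ite_eq', Finset.mem_Icc, le_refl, hN, and_self, if_true, pow_one, mul_assoc]
    ring
  · obtain ⟨d₁, d₂, d₃, h₁, h₂, h₃, heq⟩ := hsol
    -- Needed for `B = c² > 0`; the sign condition `g + cγ < 0` gives `A > 0`.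
    have hc : c ≠ 0 := by
      rintro rfl
      linarith
    have hS := isEvenJumpSmooth_of_equation hU h₁ h₂ h₃ (A := -(g + c * γ)) (B := c ^ 2)
      (p := γ ^ 2 / 2) (q₁ := g) (q₂ := g / 2) (r₁ := -(γ ^ 2 / 2)) (r₂ := γ ^ 2 / 2)
      (r₃ := γ ^ 2 / 6) (by linarith) (by positivity) (by
        filter_upwards [heq] with α h
        linear_combination -h)
    refine ⟨?_, hS.exists_bracket_expansion, hS.exists_bound⟩
    have hε0 : 0 < ε := by
      rw [hε, abs_pos]
      intro h
      have : g + c * γ = (g / γ + c) * γ := by field_simp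
      rw [h, zero_mul] at this
      linarith
    have hlam : 0 < ε / (1 + ε) ^ 2 := by positivity
    obtain ⟨b, hb⟩ := hS.exists_real_expansion hlam
    refine ⟨fun j => b j * (4 ^ j)⁻¹, fun N _ => ?_⟩
    obtain ⟨gN, hgN, hUg, ho⟩ := hb N
    refine ⟨gN, hgN, fun α => ?_, ho⟩
    rw [hUg α]
    simp only [lorentzian_pow_eq_rho, mul_assoc, div_mul_eq_mul_div]
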